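/- Let $n\ge 2$ be an integer and let $p,q,r,\alpha,\beta,\gamma,\sigma,a$ be real numbers with $$p,q\ge 1,\quad r>0,\quad 0\le a\le 1,\qquad \frac1p+\frac{\alpha}{n},\ \ \frac1q+\frac{\beta}{n},\ \ \frac1r+\frac{\gamma}{n}>0,$$ $$\gamma=a\sigma+(1-a)\beta,\qquad \frac1r+\frac{\gamma}{n}=a\left(\frac1p+\frac{\alpha-1}{n}\right)+(1-a)\left(\frac1q+\frac{\beta}{n}\right),$$ $$0\le\alpha-\sigma\ \text{ if } a>0,\qquad \alpha-\sigma\le 1\ \text{ if } a>0 \text{ and } \frac1p+\frac{\alpha-1}{n}=\frac1r+\frac{\gamma}{n}.$$ Let $C_{opt}(\mathbb{R}^n)$ be the best constant of the Euclidean Caffarelli-Kohn-Nirenberg (CKN) inequality with these parameters, that is, $$C_{opt}(\mathbb{R}^n)^{-1}=\inf_{u\in C_0^\infty(\mathbb{R}^n)\setminus\{0\}}\frac{\left(\int_{\mathbb{R}^n}|x|^{\alpha p}|\nabla u|^p\,dx\right)^{\frac ap}\left(\int_{\mathbb{R}^n}|x|^{\beta q}|u|^q\,dx\right)^{\frac{1-a}{q}}}{\left(\int_{\mathbb{R}^n}|x|^{\gamma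 r}|u|^r\,dx\right)^{\frac1r}}.$$ Let $(M^n,g)$ be a complete non-compact (connected, smooth) Riemannian manifold of dimension $n$ with volume element $dv$, let $x_0\in M$, and let $d(x)=d(x,x_0)$ be the distance to $x_0$. Suppose that there is a constant $C\in\mathbb{R}$ such that, for all $u\in C_0^\infty(M)$, $$\left(\int_M d(x)^{\gamma r}|u|^r\,dv\right)^{\frac1r}\le C\left(\int_M d(x)^{\alpha p}|\nabla u|^p\,dv\right)^{\frac ap}\left(\int_M d(x)^{\beta q}|u|^q\,dv\right)^{\frac{1-a}{q}}.$$ Then $C_{opt}(\mathbb{R}^n)\le C$. -/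

import Mathlib

open Bundle
open scoped Manifold ContDiff ENNReal

noncomputable section

section Euclidean

variable (n : ℕ)

/-- The weighted `L^t`-norm `(∫_{ℝⁿ} |x|^(w t) |f|^t dx)^(1/t)` of a function `f ≥ 0`. -/
def euclideanWeightedNorm (w t : ℝ) (f : EuclideanSpace ℝ (Fin n) → ℝ) : ℝ≥0∞ :=
  (∫⁻ x, ENNReal.ofReal (‖x‖ ^ (w * t) * f x ^ t)) ^ (1 / t)

/-- The quotient
`‖|x|^α |∇u|‖_p ^ a * ‖|x|^β u‖_q ^ (1 - a) / ‖|x|^γ u‖_r`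
on `ℝⁿ`. -/
def euclideanCKNQuotient (p q r α β γ a : ℝ) (u : EuclideanSpace ℝ (Fin n) → ℝ) : ℝ≥0∞ :=
  euclideanWeightedNorm n α p (fun x => ‖gradient u x‖) ^ a *
      euclideanWeightedNorm n β q (fun x => |u x|) ^ (1 - a) /
    euclideanWeightedNorm n γ r (fun x => |u x|)

/-- The best constant `C_opt(ℝⁿ)` in the Caffarelli-Kohn-Nirenberg inequality: its inverse is the
infimum of the quotient over all smooth compactly supported `u ≠ 0`. It is valued in `[0, ∞]`, so
that no convention for the inverse of a vanishing infimum intervenes. -/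
def euclideanCKNBestConstant (p q r α β γ a : ℝ) : ℝ≥0∞ :=
  (⨅ u ∈ {u : EuclideanSpace ℝ (Fin n) → ℝ | ContDiff ℝ ∞ u ∧ HasCompactSupport u ∧ u ≠ 0},
    euclideanCKNQuotient n p q r α β γ a u)⁻¹

end Euclidean

section Manifold

variable (n : ℕ) {M : Type*} [MetricSpace M] [ChartedSpace (EuclideanSpace ℝ (Fin n)) M]
  [RiemannianBundle (fun x : M => TangentSpace (𝓡 n) x)]

/-- The Riemannian gradient of `u` at `x`: the tangent vector `v` with `⟪v, w⟫ = du(w)` for all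
tangent vectors `w` at `x`. -/
def riemannianGradient (u : M → ℝ) (x : M) : TangentSpace (𝓡 n) x :=
  haveI : FiniteDimensional ℝ (TangentSpace (𝓡 n) x) :=
    inferInstanceAs (FiniteDimensional ℝ (EuclideanSpace ℝ (Fin n)))
  haveI : CompleteSpace (TangentSpace (𝓡 n) x) := FiniteDimensional.complete ℝ _
  (InnerProductSpace.toDual ℝ (TangentSpace (𝓡 n) x)).symm
    (mfderiv (𝓡 n) 𝓘(ℝ, ℝ) u x : TangentSpace (𝓡 n) x →L[ℝ] ℝ)

/-- The coordinate vector field `∂_i` of the preferred chart at `c`, at the point with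
coordinates `y`. -/
def chartCoordVector (c : M) (y : EuclideanSpace ℝ (Fin n)) (i : Fin n) :
    TangentSpace (𝓡 n) ((chartAt (EuclideanSpace ℝ (Fin n)) c).symm y) :=
  (mfderiv (𝓡 n) (𝓡 n) (chartAt (EuclideanSpace ℝ (Fin n)) c).symm y :
    EuclideanSpace ℝ (Fin n) →L[ℝ]
      TangentSpace (𝓡 n) ((chartAt (EuclideanSpace ℝ (Fin n)) c).symm y))
    (EuclideanSpace.single i 1)

/-- The components `g_ij = ⟪∂_i, ∂_j⟫` of the metric in the preferred chart at `c`, at the point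
with coordinates `y`. -/
def chartMetricMatrix (c : M) (y : EuclideanSpace ℝ (Fin n)) : Matrix (Fin n) (Fin n) ℝ :=
  Matrix.of fun i j => inner ℝ (chartCoordVector n c y i) (chartCoordVector n c y j)

variable [MeasurableSpace M]

/-- The measure `√(det g_ij) dx¹ ⋯ dxⁿ` of the preferred chart at `c`, carried to `M`; it is
concentrated on the domain of the chart. -/
def chartVolume (c : M) : MeasureTheory.Measure M :=
  ((MeasureTheory.volume.restrict (chartAt (EuclideanSpace ℝ (Fin n)) c).target).withDensity
      fun y => ENNReal.ofReal (√(chartMetricMatrix n c y).det)).map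
    (chartAt (EuclideanSpace ℝ (Fin n)) c).symm

/-- The Riemannian volume measure `dv`. The measures `√(det g_ij) dx` of two charts agree on the
intersection of their domains, so their supremum is the measure which coincides with
`√(det g_ij) dx` on the domain of each chart. -/
def riemannianVolume : MeasureTheory.Measure M :=
  ⨆ c : M, chartVolume n c

/-- The weighted `L^t`-norm `(∫_M d(x)^(w t) |f|^t dv)^(1/t)` of a function `f ≥ 0`, where `d` is
the distance to `x₀`. -/
def riemannianWeightedNorm (x₀ : M) (w t : ℝ) (f : M → ℝ) : ℝ≥0∞ :=
  (∫⁻ x, ENNReal.ofReal (dist x x₀ ^ (w * t) * f x ^ t) ∂(riemannianVolume n)) ^ (1 / t)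

end Manifold

end

/-! The proof is a blow-up at `x₀`. The balance condition makes the Euclidean CKN inequality
invariant under `u ↦ u (s • ·)`, so it suffices to prove it for functions supported in an
arbitrarily small ball about the origin. At that scale the manifold is nearly Euclidean.

Composing a chart with an affine map gives a chart `ψ` with `ψ x₀ = 0` whose differential at `x₀` is
an isometry. By continuity of the metric, for every `c > 1` there is a ball on which `ψ` distorts
tangent norms, the volume density and the distance to `x₀` by a factor at most `c`. Testing the
inequality on `M` with `u ∘ ψ` then gives the Euclidean inequality with constant `c ^ κ * C`, where
`κ` depends only on the parameters (`ckn_of_tsupport_subset_ball`). Rescaling removes the support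
condition (`ckn_of_comp_smul`), and `c → 1` yields the constant `C`.

Two comparisons carry the geometry. The volume is a supremum of chart measures, which change of
variables shows to be compatible (`riemannianVolume_apply`), so it can be computed in `ψ`. The
distance is an infimum over all curves, including those leaving the chart; `norm_le_dist` shows that
a sufficiently short curve cannot leave. -/

open MeasureTheory Set Filter Topology Manifold

/-! ### Gram matrices under change of charts -/

section ChartDensity

variable {n : ℕ} {M : Type*} [MetricSpace M] [ChartedSpace (EuclideanSpace ℝ (Fin n)) M]

/-- The derivative of a chart, valued in the model space. -/
noncomputable def chartDeriv (e : OpenPartialHomeomorph M (EuclideanSpace ℝ (Fin n))) (x : M) :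
    TangentSpace (𝓡 n) x →L[ℝ] EuclideanSpace ℝ (Fin n) :=
  mfderiv (𝓡 n) (𝓡 n) e x

/-- The derivative at the image of `x` of the inverse of a chart, valued in the tangent space
at `x`. -/
noncomputable def chartFrame (e : OpenPartialHomeomorph M (EuclideanSpace ℝ (Fin n))) (x : M) :
    EuclideanSpace ℝ (Fin n) →L[ℝ] TangentSpace (𝓡 n) x :=
  (chartDeriv e x).inverse

variable {e e' : OpenPartialHomeomorph M (EuclideanSpace ℝ (Fin n))}

/-- Indexing the frame by the point of `M` instead of its coordinates puts the frames of two charts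
in the same tangent space, where they can be compared. -/
theorem mfderiv_symm_eq_chartFrame (he : e.MDifferentiable (𝓡 n) (𝓡 n))
    {y : EuclideanSpace ℝ (Fin n)} (hy : y ∈ e.target) :
    (mfderiv (𝓡 n) (𝓡 n) e.symm y :
      EuclideanSpace ℝ (Fin n) →L[ℝ] TangentSpace (𝓡 n) (e.symm y)) =
      chartFrame e (e.symm y) := by
  have h1 := he.symm.symm_comp_deriv (x := y) hy
  have h2 := he.symm.comp_symm_deriv (x := e.symm y) (e.map_target hy)
  refine (ContinuousLinearMap.inverse_eq ?_ ?_).symm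
  · exact h1
  · have h3 : e.symm.symm (e.symm y) = y := e.right_inv hy
    rw [h3] at h2
    exact h2

theorem chartDeriv_isInvertible (he : e.MDifferentiable (𝓡 n) (𝓡 n)) {x : M}
    (hx : x ∈ e.source) : (chartDeriv e x).IsInvertible :=
  ⟨he.mfderiv hx, rfl⟩

theorem chartDeriv_chartFrame (he : e.MDifferentiable (𝓡 n) (𝓡 n)) {x : M}
    (hx : x ∈ e.source) (v : EuclideanSpace ℝ (Fin n)) :
    chartDeriv e x (chartFrame e x v) = v := by
  obtain ⟨L, hL⟩ := chartDeriv_isInvertible he hx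
  rw [chartFrame, ← hL, ContinuousLinearMap.inverse_equiv]
  exact L.apply_symm_apply v

theorem chartFrame_chartDeriv (he : e.MDifferentiable (𝓡 n) (𝓡 n)) {x : M}
    (hx : x ∈ e.source) (v : TangentSpace (𝓡 n) x) :
    chartFrame e x (chartDeriv e x v) = v := by
  obtain ⟨L, hL⟩ := chartDeriv_isInvertible he hx
  rw [chartFrame, ← hL, ContinuousLinearMap.inverse_equiv]
  exact L.symm_apply_apply v

/-- The derivative of a change of charts. -/
noncomputable def transitionDeriv (e e' : OpenPartialHomeomorph M (EuclideanSpace ℝ (Fin n)))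
    (x : M) : EuclideanSpace ℝ (Fin n) →L[ℝ] EuclideanSpace ℝ (Fin n) :=
  (chartDeriv e x).comp (chartFrame e' x)

theorem hasFDerivAt_transition (he : e.MDifferentiable (𝓡 n) (𝓡 n))
    (he' : e'.MDifferentiable (𝓡 n) (𝓡 n)) {y : EuclideanSpace ℝ (Fin n)}
    (hy : y ∈ e'.target) (hy' : e'.symm y ∈ e.source) :
    HasFDerivAt (fun z => e (e'.symm z)) (transitionDeriv e e' (e'.symm y)) y := by
  have h1 := (he'.symm.mdifferentiableAt (x := y) hy).hasMFDerivAt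
  have h2 := (he.mdifferentiableAt hy').hasMFDerivAt
  have h3 := h2.comp y h1
  rw [hasMFDerivAt_iff_hasFDerivAt] at h3
  convert h3 using 1
  rw [transitionDeriv, ← mfderiv_symm_eq_chartFrame he' hy]
  rfl

variable [RiemannianBundle (fun x : M => TangentSpace (𝓡 n) x)]

/-- The Gram matrix at `x` of the coordinate vectors of a chart. -/
noncomputable def chartGram (e : OpenPartialHomeomorph M (EuclideanSpace ℝ (Fin n))) (x : M) :
    Matrix (Fin n) (Fin n) ℝ :=
  Matrix.of fun i j => inner ℝ (chartFrame e x (EuclideanSpace.single i 1))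
    (chartFrame e x (EuclideanSpace.single j 1))

theorem chartMetricMatrix_eq_chartGram (c : M)
    (he : (chartAt (EuclideanSpace ℝ (Fin n)) c).MDifferentiable (𝓡 n) (𝓡 n))
    {y : EuclideanSpace ℝ (Fin n)} (hy : y ∈ (chartAt (EuclideanSpace ℝ (Fin n)) c).target) :
    chartMetricMatrix n c y =
      chartGram (chartAt (EuclideanSpace ℝ (Fin n)) c)
        ((chartAt (EuclideanSpace ℝ (Fin n)) c).symm y) := by
  have := mfderiv_symm_eq_chartFrame he hy
  ext i j
  simp only [chartMetricMatrix, chartGram, Matrix.of_apply, chartCoordVector]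
  rw [this]
  rfl

/-- The frames are related by the Jacobian matrix `J` of the transition map, so the Gram matrices
satisfy `G' = Jᵀ G J`. -/
theorem chartGram_transition (he : e.MDifferentiable (𝓡 n) (𝓡 n)) {x : M}
    (hx : x ∈ e.source) :
    (chartGram e' x).det = (transitionDeriv e e' x).det ^ 2 * (chartGram e x).det := by
  let b := (EuclideanSpace.basisFun (Fin n) ℝ).toBasis
  let J := LinearMap.toMatrix b b (transitionDeriv e e' x : _ →ₗ[ℝ] _)
  have hJ (i : Fin n) : chartFrame e' x (EuclideanSpace.single i 1) =
      ∑ k, J k i • chartFrame e x (EuclideanSpace.single k 1) := by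
    have h1 : transitionDeriv e e' x (EuclideanSpace.single i 1) =
        ∑ k, J k i • EuclideanSpace.single k (1 : ℝ) := by
      have h0 := (EuclideanSpace.basisFun (Fin n) ℝ).sum_repr
        (transitionDeriv e e' x (EuclideanSpace.single i 1))
      rw [← h0]
      refine Finset.sum_congr rfl fun k _ => ?_
      simp [J, b, LinearMap.toMatrix_apply]
    have h2 := congrArg (chartFrame e x) h1
    rw [transitionDeriv, ContinuousLinearMap.comp_apply, chartFrame_chartDeriv he hx] at h2
    rw [h2, map_sum]
    simp only [map_smul]
  have hG : chartGram e' x = J.transpose * chartGram e x * J := by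
    ext i j
    simp only [chartGram, Matrix.of_apply, hJ, Matrix.mul_apply, Matrix.transpose_apply,
      sum_inner, inner_sum, inner_smul_left, inner_smul_right, Finset.sum_mul, Finset.mul_sum]
    refine Finset.sum_congr rfl fun k _ => Finset.sum_congr rfl fun l _ => ?_
    simp
    ring
  have hdet : J.det = (transitionDeriv e e' x).det := LinearMap.det_toMatrix b _
  rw [hG, Matrix.det_mul, Matrix.det_mul, Matrix.det_transpose, hdet]
  ring

end ChartDensity

/-! ### The Riemannian volume computed in a chart -/

theorem measurableSet_target_inter_preimage_symm {X Y : Type*} [TopologicalSpace X]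
    [MeasurableSpace X] [BorelSpace X] [TopologicalSpace Y] [MeasurableSpace Y] [BorelSpace Y]
    (e : OpenPartialHomeomorph X Y) {A : Set X} (hA : MeasurableSet A) :
    MeasurableSet (e.target ∩ e.symm ⁻¹' A) := by
  -- `e.symm` is controlled only on the target, hence the passage through the subtype.
  have h : Measurable (e.target.domRestrict e.symm) :=
    (continuousOn_iff_continuous_domRestrict.1 e.continuousOn_symm).measurable
  have := e.open_target.measurableSet.subtype_image (h hA)
  convert this using 1
  ext y
  simp [Set.domRestrict_apply, and_comm]

section ChartMeasure

variable {n : ℕ} {M : Type*} [MetricSpace M] [ChartedSpace (EuclideanSpace ℝ (Fin n)) M]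
  [RiemannianBundle (fun x : M => TangentSpace (𝓡 n) x)]

/-- The Riemannian volume density of a chart. -/
noncomputable def chartDensity (e : OpenPartialHomeomorph M (EuclideanSpace ℝ (Fin n))) (x : M) :
    ℝ :=
  √(chartGram e x).det

variable {e e' : OpenPartialHomeomorph M (EuclideanSpace ℝ (Fin n))}

theorem chartDensity_transition (he : e.MDifferentiable (𝓡 n) (𝓡 n)) {x : M}
    (hx : x ∈ e.source) :
    chartDensity e' x = |(transitionDeriv e e' x).det| * chartDensity e x := by
  rw [chartDensity, chartGram_transition he hx, Real.sqrt_mul (sq_nonneg _), Real.sqrt_sq_eq_abs,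
    chartDensity]

variable [MeasurableSpace M]

/-- The Riemannian volume measure of the domain of a chart. -/
noncomputable def chartMeasure (e : OpenPartialHomeomorph M (EuclideanSpace ℝ (Fin n))) :
    Measure M :=
  ((volume.restrict e.target).withDensity
    fun y => ENNReal.ofReal (chartDensity e (e.symm y))).map e.symm

theorem chartVolume_eq_chartMeasure (c : M)
    (he : (chartAt (EuclideanSpace ℝ (Fin n)) c).MDifferentiable (𝓡 n) (𝓡 n)) :
    chartVolume n c = chartMeasure (chartAt (EuclideanSpace ℝ (Fin n)) c) := by
  rw [chartVolume, chartMeasure]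
  congr 1
  refine withDensity_congr_ae ?_
  filter_upwards [ae_restrict_mem (chartAt (EuclideanSpace ℝ (Fin n)) c).open_target.measurableSet]
    with y hy
  rw [chartMetricMatrix_eq_chartGram c he hy, chartDensity]

variable [BorelSpace M]

theorem chartMeasure_apply (e : OpenPartialHomeomorph M (EuclideanSpace ℝ (Fin n))) {A : Set M}
    (hA : MeasurableSet A) :
    chartMeasure e A = ∫⁻ y in e.target ∩ e.symm ⁻¹' A,
      ENNReal.ofReal (chartDensity e (e.symm y)) := by
  have h : AEMeasurable e.symm (volume.restrict e.target) :=
    e.continuousOn_symm.aemeasurable e.open_target.measurableSet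
  rw [chartMeasure, Measure.map_apply_of_aemeasurable
    (h.mono_ac (withDensity_absolutelyContinuous _ _)) hA, withDensity_apply',
    Measure.restrict_restrict' e.open_target.measurableSet, inter_comm]

theorem chartMeasure_compl_source (e : OpenPartialHomeomorph M (EuclideanSpace ℝ (Fin n))) :
    chartMeasure e e.sourceᶜ = 0 := by
  rw [chartMeasure_apply e e.open_source.measurableSet.compl]
  have : e.target ∩ e.symm ⁻¹' e.sourceᶜ = ∅ := by
    ext y
    simpa using fun hy => e.map_target hy
  rw [this, Measure.restrict_empty, lintegral_zero_measure]

/-- The Jacobian factor from the change of variables is exactly the factor by which the densities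
differ (`chartDensity_transition`). -/
theorem chartMeasure_eq_of_subset (he : e.MDifferentiable (𝓡 n) (𝓡 n))
    (he' : e'.MDifferentiable (𝓡 n) (𝓡 n)) {A : Set M} (hA : MeasurableSet A)
    (hAe : A ⊆ e.source) (hAe' : A ⊆ e'.source) :
    chartMeasure e' A = chartMeasure e A := by
  rw [chartMeasure_apply e hA, chartMeasure_apply e' hA]
  have him : e.target ∩ e.symm ⁻¹' A =
      (fun z => e (e'.symm z)) '' (e'.target ∩ e'.symm ⁻¹' A) := by
    ext y
    constructor
    · rintro ⟨hy, hyA⟩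
      refine ⟨e' (e.symm y), ⟨e'.map_source (hAe' hyA), ?_⟩, ?_⟩
      · simpa [e'.left_inv (hAe' hyA)] using hyA
      · simp [e'.left_inv (hAe' hyA), e.right_inv hy]
    · rintro ⟨z, ⟨hz, hzA⟩, rfl⟩
      refine ⟨e.map_source (hAe hzA), ?_⟩
      simpa [e.left_inv (hAe hzA)] using hzA
  rw [him, lintegral_image_eq_lintegral_abs_det_fderiv_mul volume
    (measurableSet_target_inter_preimage_symm e' hA)
    (fun y hy => (hasFDerivAt_transition he he' hy.1 (hAe hy.2)).hasFDerivWithinAt)]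
  · refine setLIntegral_congr_fun (measurableSet_target_inter_preimage_symm e' hA) fun y hy => ?_
    rw [e.left_inv (hAe hy.2), chartDensity_transition he (hAe hy.2),
      ENNReal.ofReal_mul (abs_nonneg _)]
  · intro y hy z hz hyz
    exact e'.symm.injOn hy.1 hz.1 (e.injOn (hAe hy.2) (hAe hz.2) hyz)

/-- A supremum of measures is not computed setwise. The upper bound comes from one measure
dominating every chart volume, the lower bound from the single preferred chart whose domain contains
`A`. -/
theorem riemannianVolume_apply [IsManifold (𝓡 n) 1 M] (he : e.MDifferentiable (𝓡 n) (𝓡 n)) {c : M}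
    {A : Set M} (hA : MeasurableSet A) (hAe : A ⊆ e.source)
    (hAc : A ⊆ (chartAt (EuclideanSpace ℝ (Fin n)) c).source) :
    riemannianVolume n A = chartMeasure e A := by
  have hd (c : M) : (chartAt (EuclideanSpace ℝ (Fin n)) c).MDifferentiable (𝓡 n) (𝓡 n) :=
    mdifferentiable_chart c
  refine le_antisymm ?_ ?_
  -- Off `e.source` the top measure dominates trivially; on `e.source` the chart measures agree on
  -- the overlap. The correction vanishes on `A`.
  · have hle : riemannianVolume n ≤ chartMeasure e + (⊤ : Measure M).restrict e.sourceᶜ := by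
      refine iSup_le fun c => Measure.le_iff.2 fun B hB => ?_
      have hS := e.open_source.measurableSet
      have hS' := (chartAt (EuclideanSpace ℝ (Fin n)) c).open_source.measurableSet
      rw [chartVolume_eq_chartMeasure c (hd c), Measure.add_apply, Measure.restrict_apply hB,
        ← measure_inter_add_sdiff B hS]
      refine add_le_add ?_ (Measure.le_iff'.1 le_top _)
      rw [← measure_inter_add_sdiff (B ∩ e.source) hS',
        measure_mono_null (s := (B ∩ e.source) \ _) (fun x hx => hx.2)
          (chartMeasure_compl_source _), add_zero,
        chartMeasure_eq_of_subset he (hd c) ((hB.inter hS).inter hS')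
          (inter_subset_left.trans inter_subset_right) inter_subset_right]
      exact measure_mono (inter_subset_left.trans inter_subset_left)
    refine (hle A).trans ?_
    rw [Measure.add_apply, Measure.restrict_apply hA]
    have : A ∩ e.sourceᶜ = ∅ := by
      rw [← sdiff_eq, sdiff_eq_empty.2 hAe]
    simp [this]
  · rw [← chartMeasure_eq_of_subset he (hd c) hA hAe hAc, ← chartVolume_eq_chartMeasure c (hd c)]
    exact (le_iSup (fun c => chartVolume n c) c) A

end ChartMeasure

/-! ### Charts that are almost isometric near their centre -/

section AlmostIsometricChart

variable {n : ℕ} {M : Type*} [MetricSpace M] [ChartedSpace (EuclideanSpace ℝ (Fin n)) M]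
  [RiemannianBundle (fun x : M => TangentSpace (𝓡 n) x)]

/-- A smooth chart centred at `x₀` whose derivative is almost isometric near `x₀`. -/
structure IsAlmostIsometricChart (x₀ : M)
    (ψ : OpenPartialHomeomorph M (EuclideanSpace ℝ (Fin n))) : Prop where
  source_eq : ψ.source = (chartAt (EuclideanSpace ℝ (Fin n)) x₀).source
  apply_self : ψ x₀ = 0
  contMDiffOn : ContMDiffOn (𝓡 n) (𝓡 n) ∞ ψ ψ.source
  contMDiffOn_symm : ContMDiffOn (𝓡 n) (𝓡 n) ∞ ψ.symm ψ.target
  eventually_norm_le : ∀ c : ℝ, 1 < c → ∀ᶠ x in 𝓝 x₀, ∀ v : TangentSpace (𝓡 n) x,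
    ‖chartDeriv ψ x v‖ ≤ c * ‖v‖ ∧ ‖v‖ ≤ c * ‖chartDeriv ψ x v‖

/-- Only the differential at `x₀` needs normalising, which an affine change of coordinates does;
continuity of the metric gives the bounds nearby. -/
theorem exists_isAlmostIsometricChart [IsManifold (𝓡 n) ∞ M]
    [IsContinuousRiemannianBundle (EuclideanSpace ℝ (Fin n))
      (fun x : M => TangentSpace (𝓡 n) x)] (x₀ : M) :
    ∃ ψ : OpenPartialHomeomorph M (EuclideanSpace ℝ (Fin n)), IsAlmostIsometricChart x₀ ψ := by
  let φ := chartAt (EuclideanSpace ℝ (Fin n)) x₀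
  let t := trivializationAt (EuclideanSpace ℝ (Fin n)) (fun x : M => TangentSpace (𝓡 n) x) x₀
  have h₀ : x₀ ∈ t.baseSet := FiberBundle.mem_baseSet_trivializationAt' x₀
  have : FiniteDimensional ℝ (TangentSpace (𝓡 n) x₀) :=
    inferInstanceAs (FiniteDimensional ℝ (EuclideanSpace ℝ (Fin n)))
  have hfin : Module.finrank ℝ (TangentSpace (𝓡 n) x₀) = n :=
    (finrank_euclideanSpace_fin (𝕜 := ℝ) (n := n) :
      Module.finrank ℝ (EuclideanSpace ℝ (Fin n)) = n)
  let L₀ : TangentSpace (𝓡 n) x₀ ≃ₗᵢ[ℝ] EuclideanSpace ℝ (Fin n) :=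
    ((stdOrthonormalBasis ℝ (TangentSpace (𝓡 n) x₀)).reindex (finCongr hfin)).repr
  -- Carry model vectors to the tangent space at `x₀` by the trivialization, then read them in an
  -- orthonormal basis there.
  let L : EuclideanSpace ℝ (Fin n) ≃L[ℝ] EuclideanSpace ℝ (Fin n) :=
    (ContinuousLinearEquiv.equivOfInverse (t.symmL ℝ x₀) (t.continuousLinearMapAt ℝ x₀)
      (fun w => t.continuousLinearMapAt_symmL h₀ w)
      (fun v => t.symmL_continuousLinearMapAt h₀ v)).trans L₀.toContinuousLinearEquiv
  have hL (w : EuclideanSpace ℝ (Fin n)) : ‖L w‖ = ‖t.symmL ℝ x₀ w‖ := by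
    change ‖L₀ _‖ = _
    rw [L₀.norm_map]
    rfl
  let h : EuclideanSpace ℝ (Fin n) ≃ₜ EuclideanSpace ℝ (Fin n) :=
    (Homeomorph.subRight (φ x₀)).trans L.toHomeomorph
  have hh : ContDiff ℝ ∞ h := L.contDiff.comp (contDiff_id.sub contDiff_const)
  have hh' : ContDiff ℝ ∞ h.symm := by
    change ContDiff ℝ ∞ (fun y => L.symm y + φ x₀)
    exact L.symm.contDiff.add contDiff_const
  have hφ₁ : ContMDiffOn (𝓡 n) (𝓡 n) ∞ φ φ.source := contMDiffOn_chart
  have hφ₂ : ContMDiffOn (𝓡 n) (𝓡 n) ∞ φ.symm φ.target := contMDiffOn_chart_symm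
  have hderiv {x : M} (hx : x ∈ φ.source) (v : TangentSpace (𝓡 n) x) :
      chartDeriv (φ.transHomeomorph h) x v = L (t.continuousLinearMapAt ℝ x v) := by
    have h1 : HasMFDerivAt (𝓡 n) (𝓡 n) φ x (t.continuousLinearMapAt ℝ x) := by
      have h1 := (mdifferentiable_chart (I := 𝓡 n) x₀).mdifferentiableAt hx
      rw [TangentBundle.continuousLinearMapAt_trivializationAt (I := 𝓡 n) hx,
        (hasMFDerivAt_extChartAt hx).mfderiv]
      exact h1.hasMFDerivAt
    have h2 : HasFDerivAt h (L : EuclideanSpace ℝ (Fin n) →L[ℝ] EuclideanSpace ℝ (Fin n)) (φ x) :=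
      L.hasFDerivAt.comp (φ x) ((hasFDerivAt_id (φ x)).sub_const (φ x₀))
    have h3 := h2.hasMFDerivAt.comp x h1
    have h4 := h3.mfderiv
    exact congr($h4 v)
  refine ⟨φ.transHomeomorph h, rfl, ?_, ?_, ?_, fun c hc => ?_⟩
  · change L (φ x₀ - φ x₀) = 0
    simp
  · exact hh.contMDiff.comp_contMDiffOn hφ₁
  · exact hφ₂.comp hh'.contMDiff.contMDiffOn (fun y hy => hy)
  · have hsrc : φ.source ∈ 𝓝 x₀ := chart_source_mem_nhds _ x₀
    filter_upwards [hsrc,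
      eventually_norm_symmL_trivializationAt_self_comp_lt (EuclideanSpace ℝ (Fin n))
        (fun x : M => TangentSpace (𝓡 n) x) x₀ hc,
      eventually_norm_symmL_trivializationAt_comp_self_lt (EuclideanSpace ℝ (Fin n))
        (fun x : M => TangentSpace (𝓡 n) x) x₀ hc] with x hx h1 h2 v
    -- The norm is now that of `v` transported to the tangent space at `x₀`. This transport and its
    -- inverse both have norm below `c` near `x₀`.
    rw [hderiv hx, hL]
    refine ⟨((ContinuousLinearMap.le_opNorm _ v).trans
      (mul_le_mul_of_nonneg_right h1.le (norm_nonneg v))), ?_⟩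
    have h3 := (ContinuousLinearMap.le_opNorm _
      (t.symmL ℝ x₀ (t.continuousLinearMapAt ℝ x v))).trans
      (mul_le_mul_of_nonneg_right h2.le (norm_nonneg _))
    rw [ContinuousLinearMap.comp_apply, t.continuousLinearMapAt_symmL h₀,
      t.symmL_continuousLinearMapAt hx] at h3
    exact h3

end AlmostIsometricChart

section AlmostIsometricChart

variable {n : ℕ} {M : Type*} [MetricSpace M] [ChartedSpace (EuclideanSpace ℝ (Fin n)) M]
  [RiemannianBundle (fun x : M => TangentSpace (𝓡 n) x)] {x₀ : M}
  {ψ : OpenPartialHomeomorph M (EuclideanSpace ℝ (Fin n))}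

namespace IsAlmostIsometricChart

theorem mdifferentiable (h : IsAlmostIsometricChart x₀ ψ) : ψ.MDifferentiable (𝓡 n) (𝓡 n) :=
  ⟨h.contMDiffOn.mdifferentiableOn (by simp), h.contMDiffOn_symm.mdifferentiableOn (by simp)⟩

theorem mem_source (h : IsAlmostIsometricChart x₀ ψ) : x₀ ∈ ψ.source := by
  rw [h.source_eq]
  exact mem_chart_source _ x₀

theorem source_mem_nhds (h : IsAlmostIsometricChart x₀ ψ) : ψ.source ∈ 𝓝 x₀ :=
  ψ.open_source.mem_nhds h.mem_source

theorem tendsto_norm_chartFrame (h : IsAlmostIsometricChart x₀ ψ)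
    (w : EuclideanSpace ℝ (Fin n)) :
    Tendsto (fun x => ‖chartFrame ψ x w‖) (𝓝 x₀) (𝓝 ‖w‖) := by
  have key (c : ℝ) (hc : 1 < c) : ∀ᶠ x in 𝓝 x₀,
      c⁻¹ * ‖w‖ ≤ ‖chartFrame ψ x w‖ ∧ ‖chartFrame ψ x w‖ ≤ c * ‖w‖ := by
    filter_upwards [h.source_mem_nhds, h.eventually_norm_le c hc] with x hx hx'
    have := hx' (chartFrame ψ x w)
    rw [chartDeriv_chartFrame h.mdifferentiable hx] at this
    exact ⟨(inv_mul_le_iff₀ (by linarith)).2 this.1, this.2⟩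
  rw [tendsto_order]
  constructor
  · intro b hb
    have : ∀ᶠ c : ℝ in 𝓝[>] 1, b < c⁻¹ * ‖w‖ := by
      have : Tendsto (fun c : ℝ => c⁻¹ * ‖w‖) (𝓝[>] 1) (𝓝 ((1 : ℝ)⁻¹ * ‖w‖)) :=
        ((tendsto_inv₀ one_ne_zero).mono_left nhdsWithin_le_nhds).mul_const _
      rw [inv_one, one_mul] at this
      exact this.eventually_const_lt hb
    obtain ⟨c, hbc, hc⟩ := (this.and self_mem_nhdsWithin).exists
    filter_upwards [key c hc] with x hx using hbc.trans_le hx.1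
  · intro b hb
    have : ∀ᶠ c : ℝ in 𝓝[>] 1, c * ‖w‖ < b := by
      have : Tendsto (fun c : ℝ => c * ‖w‖) (𝓝[>] 1) (𝓝 (1 * ‖w‖)) :=
        (tendsto_id.mono_left nhdsWithin_le_nhds).mul_const _
      rw [one_mul] at this
      exact this.eventually_lt_const hb
    obtain ⟨c, hbc, hc⟩ := (this.and self_mem_nhdsWithin).exists
    filter_upwards [key c hc] with x hx using hx.2.trans_lt hbc

/-- By polarization the Gram entries are combinations of squared norms of frame vectors, which tend
to their Euclidean values; so the Gram matrix tends to the identity. -/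
theorem tendsto_chartDensity (h : IsAlmostIsometricChart x₀ ψ) :
    Tendsto (chartDensity ψ) (𝓝 x₀) (𝓝 1) := by
  have hG : Tendsto (chartGram ψ) (𝓝 x₀) (𝓝 1) := by
    refine tendsto_pi_nhds.2 fun i => tendsto_pi_nhds.2 fun j => ?_
    have h1 : (fun x => chartGram ψ x i j) = fun x =>
        (‖chartFrame ψ x (EuclideanSpace.single i 1 + EuclideanSpace.single j 1)‖ *
            ‖chartFrame ψ x (EuclideanSpace.single i 1 + EuclideanSpace.single j 1)‖ -
          ‖chartFrame ψ x (EuclideanSpace.single i 1)‖ *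
            ‖chartFrame ψ x (EuclideanSpace.single i 1)‖ -
          ‖chartFrame ψ x (EuclideanSpace.single j 1)‖ *
            ‖chartFrame ψ x (EuclideanSpace.single j 1)‖) / 2 := by
      ext x
      rw [map_add]
      exact real_inner_eq_norm_add_mul_self_sub_norm_mul_self_sub_norm_mul_self_div_two
        (F := TangentSpace (𝓡 n) x) _ _
    have h2 : (1 : Matrix (Fin n) (Fin n) ℝ) i j =
        (‖(EuclideanSpace.single i 1 + EuclideanSpace.single j 1 : EuclideanSpace ℝ (Fin n))‖ *
            ‖(EuclideanSpace.single i 1 + EuclideanSpace.single j 1 : EuclideanSpace ℝ (Fin n))‖ -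
          ‖(EuclideanSpace.single i 1 : EuclideanSpace ℝ (Fin n))‖ *
            ‖(EuclideanSpace.single i 1 : EuclideanSpace ℝ (Fin n))‖ -
          ‖(EuclideanSpace.single j 1 : EuclideanSpace ℝ (Fin n))‖ *
            ‖(EuclideanSpace.single j 1 : EuclideanSpace ℝ (Fin n))‖) / 2 := by
      rw [← real_inner_eq_norm_add_mul_self_sub_norm_mul_self_sub_norm_mul_self_div_two]
      simp [Matrix.one_apply, EuclideanSpace.inner_single_left]
    rw [h1, h2]
    have hn := h.tendsto_norm_chartFrame
    exact ((((hn _).mul (hn _)).sub ((hn _).mul (hn _))).sub ((hn _).mul (hn _))).div_const 2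
  have h3 : Continuous fun A : Matrix (Fin n) (Fin n) ℝ => √A.det :=
    continuous_id.matrix_det.sqrt
  rw [show (1 : ℝ) = √(1 : Matrix (Fin n) (Fin n) ℝ).det by simp]
  exact (h3.tendsto 1).comp hG

/-- Almost isometry of a centred chart in quantitative form: on the ball of radius `ρ` its
derivative is `c`-bi-Lipschitz and its volume density is between `c⁻¹` and `c`. -/
theorem exists_ball (h : IsAlmostIsometricChart x₀ ψ) {c : ℝ} (hc : 1 < c) :
    ∃ ρ > 0, Metric.ball 0 ρ ⊆ ψ.target ∧ ∀ x ∈ ψ.source, ψ x ∈ Metric.ball 0 ρ →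
      (∀ v : TangentSpace (𝓡 n) x,
        ‖chartDeriv ψ x v‖ ≤ c * ‖v‖ ∧ ‖v‖ ≤ c * ‖chartDeriv ψ x v‖) ∧
      c⁻¹ ≤ chartDensity ψ x ∧ chartDensity ψ x ≤ c := by
  have h1 : ∀ᶠ x in 𝓝 x₀, (∀ v : TangentSpace (𝓡 n) x,
        ‖chartDeriv ψ x v‖ ≤ c * ‖v‖ ∧ ‖v‖ ≤ c * ‖chartDeriv ψ x v‖) ∧
      c⁻¹ ≤ chartDensity ψ x ∧ chartDensity ψ x ≤ c := by
    filter_upwards [h.eventually_norm_le c hc,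
      h.tendsto_chartDensity.eventually_const_le (inv_lt_one_of_one_lt₀ hc),
      h.tendsto_chartDensity.eventually_le_const hc] with x hx hx' hx''
    exact ⟨hx, hx', hx''⟩
  have h0 : (0 : EuclideanSpace ℝ (Fin n)) ∈ ψ.target := by
    rw [← h.apply_self]
    exact ψ.map_source h.mem_source
  have h2 : Tendsto ψ.symm (𝓝 0) (𝓝 x₀) := by
    have := ψ.symm.continuousAt (x := 0) h0
    rw [ContinuousAt, ← h.apply_self] at this
    rwa [ψ.left_inv h.mem_source, h.apply_self] at this
  obtain ⟨ρ, hρ, hball⟩ := Metric.mem_nhds_iff.1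
    (inter_mem (ψ.open_target.mem_nhds h0) (h2 h1))
  refine ⟨ρ, hρ, fun y hy => (hball hy).1, fun x hx hxρ => ?_⟩
  have := (hball hxρ).2
  rw [mem_preimage, ψ.left_inv hx] at this
  exact this

end IsAlmostIsometricChart

end AlmostIsometricChart

/-! ### Distance to the centre versus coordinate norm -/

section ChartDistance

variable {n : ℕ} {M : Type*} [MetricSpace M] [ChartedSpace (EuclideanSpace ℝ (Fin n)) M]
  [RiemannianBundle (fun x : M => TangentSpace (𝓡 n) x)] {x₀ : M}
  {ψ : OpenPartialHomeomorph M (EuclideanSpace ℝ (Fin n))} {c ρ : ℝ}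

namespace IsAlmostIsometricChart

/-- The coordinate segment from `0` to `ψ x` stays in the ball, and its image in `M` is a competitor
of length at most `c * ‖ψ x‖`. -/
theorem dist_le [IsManifold (𝓡 n) 1 M] [IsRiemannianManifold (𝓡 n) M]
    (h : IsAlmostIsometricChart x₀ ψ) (hc : 0 < c) (hball : Metric.ball 0 ρ ⊆ ψ.target)
    (hD : ∀ x ∈ ψ.source, ψ x ∈ Metric.ball 0 ρ → ∀ v : TangentSpace (𝓡 n) x,
      ‖v‖ ≤ c * ‖chartDeriv ψ x v‖)
    {x : M} (hx : x ∈ ψ.source) (hxρ : ψ x ∈ Metric.ball 0 ρ) :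
    dist x x₀ ≤ c * ‖ψ x‖ := by
  set y := ψ x with hy
  let γ : ℝ → M := fun t => ψ.symm (t • y)
  have hmem {t : ℝ} (ht : t ∈ Icc (0 : ℝ) 1) :
      t • y ∈ Metric.ball (0 : EuclideanSpace ℝ (Fin n)) ρ := by
    rw [mem_ball_zero_iff] at hxρ ⊢
    rw [norm_smul, Real.norm_of_nonneg ht.1]
    exact (mul_le_of_le_one_left (norm_nonneg _) ht.2).trans_lt hxρ
  have hline : ContMDiff 𝓘(ℝ, ℝ) (𝓡 n) ∞ (fun t : ℝ => t • y) :=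
    (contDiff_id.smul contDiff_const).contMDiff
  have hγ : ContMDiffOn 𝓘(ℝ, ℝ) (𝓡 n) 1 γ (Icc 0 1) :=
    (h.contMDiffOn_symm.comp hline.contMDiffOn (fun t ht => hball (hmem ht))).of_le (by simp)
  have hlen : riemannianEDist (𝓡 n) x₀ x ≤ pathELength (𝓡 n) γ 0 1 := by
    refine riemannianEDist_le_pathELength hγ ?_ ?_ zero_le_one
    · simp only [γ, zero_smul]
      rw [← h.apply_self, ψ.left_inv h.mem_source]
    · simp only [γ, one_smul, hy]
      exact ψ.left_inv hx
  have hbound : pathELength (𝓡 n) γ 0 1 ≤ ENNReal.ofReal (c * ‖y‖) := by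
    rw [pathELength_eq_lintegral_mfderiv_Icc]
    calc _ ≤ ∫⁻ t in Icc (0 : ℝ) 1, ENNReal.ofReal (c * ‖y‖) := by
          refine setLIntegral_mono' measurableSet_Icc fun t ht => ?_
          have ht' := hball (hmem ht)
          have h1 : HasFDerivAt (fun t : ℝ => t • y) (ContinuousLinearMap.toSpanSingleton ℝ y) t :=
            (hasDerivAt_id t).smul_const y |>.hasFDerivAt.congr_fderiv (by ext; simp)
          have h2 := ((h.mdifferentiable.symm.mdifferentiableAt (x := t • y) ht').hasMFDerivAt.comp t
            h1.hasMFDerivAt).mfderiv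
          have h3 : mfderiv 𝓘(ℝ, ℝ) (𝓡 n) γ t (1 : ℝ) = chartFrame ψ (γ t) y := by
            rw [← mfderiv_symm_eq_chartFrame h.mdifferentiable ht']
            have h4 := congr($h2 (1 : ℝ))
            have h5 : ContinuousLinearMap.toSpanSingleton ℝ y (1 : ℝ) = y := by simp
            exact h4.trans (congrArg (fun w : EuclideanSpace ℝ (Fin n) =>
              (mfderiv (𝓡 n) (𝓡 n) ψ.symm (t • y) : EuclideanSpace ℝ (Fin n) →L[ℝ]
                TangentSpace (𝓡 n) (ψ.symm (t • y))) w) h5)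
          rw [← ofReal_norm]
          refine ENNReal.ofReal_le_ofReal ?_
          have h5 := hD (γ t) (ψ.map_target ht')
            (by simpa only [γ, ψ.right_inv ht'] using hmem ht) (chartFrame ψ (γ t) y)
          rw [chartDeriv_chartFrame h.mdifferentiable (ψ.map_target ht')] at h5
          exact (congrArg norm h3).le.trans h5
      _ = _ := by simp
  have := (IsRiemannianManifold.out (I := 𝓡 n) x₀ x).le.trans (hlen.trans hbound)
  rw [edist_dist, ENNReal.ofReal_le_ofReal_iff (by positivity)] at this
  rwa [dist_comm]

theorem enorm_sub_le_pathELength (h : IsAlmostIsometricChart x₀ ψ) (hc : 0 < c)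
    (hD : ∀ x ∈ ψ.source, ψ x ∈ Metric.ball 0 ρ → ∀ v : TangentSpace (𝓡 n) x,
      ‖chartDeriv ψ x v‖ ≤ c * ‖v‖)
    {γ : ℝ → M} (hγ : ContMDiff 𝓘(ℝ, ℝ) (𝓡 n) 1 γ) {t : ℝ} (ht : 0 ≤ t)
    (hmem : ∀ s ∈ Icc 0 t, γ s ∈ ψ.source ∧ ψ (γ s) ∈ Metric.ball 0 ρ) :
    ‖ψ (γ t) - ψ (γ 0)‖ₑ ≤ ENNReal.ofReal c * pathELength (𝓡 n) γ 0 t := by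
  rcases ht.eq_or_lt with rfl | ht'
  · simp
  let γ' : ℝ → EuclideanSpace ℝ (Fin n) := ψ ∘ γ
  have hC : ContMDiffOn 𝓘(ℝ, ℝ) (𝓡 n) 1 γ' (Icc 0 t) :=
    (h.contMDiffOn.of_le (by simp)).comp hγ.contMDiffOn fun s hs => (hmem s hs).1
  calc ‖γ' t - γ' 0‖ₑ
    _ ≤ ∫⁻ s in Icc 0 t, ‖derivWithin γ' (Icc 0 t) s‖ₑ := by
      apply enorm_sub_le_lintegral_derivWithin_Icc_of_contDiffOn_Icc _ ht
      rwa [← contMDiffOn_iff_contDiffOn]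
    _ ≤ ∫⁻ s in Icc 0 t, ENNReal.ofReal c *
        ‖mfderivWithin 𝓘(ℝ, ℝ) (𝓡 n) γ (Icc 0 t) s (1 : ℝ)‖ₑ := by
      refine setLIntegral_mono' measurableSet_Icc fun s hs => ?_
      have h1 := mfderiv_comp_mfderivWithin s (h.mdifferentiable.mdifferentiableAt (hmem s hs).1)
        ((hγ.mdifferentiable one_ne_zero).mdifferentiableOn (s := Icc 0 t) s hs)
        (by
          rw [uniqueMDiffWithinAt_iff_uniqueDiffWithinAt]
          exact uniqueDiffOn_Icc ht' _ hs)
      rw [mfderivWithin_eq_fderivWithin] at h1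
      have h2 : derivWithin γ' (Icc 0 t) s =
          chartDeriv ψ (γ s) (mfderivWithin 𝓘(ℝ, ℝ) (𝓡 n) γ (Icc 0 t) s (1 : ℝ)) := by
        rw [← fderivWithin_derivWithin]
        exact congr($h1 (1 : ℝ))
      rw [h2, ← ofReal_norm, ← ofReal_norm, ← ENNReal.ofReal_mul hc.le]
      exact ENNReal.ofReal_le_ofReal (hD _ (hmem s hs).1 (hmem s hs).2 _)
    _ = ENNReal.ofReal c * pathELength (𝓡 n) γ 0 t := by
      rw [lintegral_const_mul' _ _ ENNReal.ofReal_ne_top,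
        pathELength_eq_lintegral_mfderivWithin_Icc]
      rfl

/-- If the bound failed, some curve from `x₀` to `x` would have length below `‖ψ x‖ / c`. While it
remains in the closed coordinate ball of radius `‖ψ x‖`, its coordinate norm is strictly below that
radius; so it never exits, and its endpoint contradicts this strict inequality. -/
theorem norm_le_dist [IsRiemannianManifold (𝓡 n) M]
    (h : IsAlmostIsometricChart x₀ ψ) (hc : 0 < c) (hball : Metric.ball 0 ρ ⊆ ψ.target)
    (hD : ∀ x ∈ ψ.source, ψ x ∈ Metric.ball 0 ρ → ∀ v : TangentSpace (𝓡 n) x,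
      ‖chartDeriv ψ x v‖ ≤ c * ‖v‖)
    {x : M} (hxρ : ψ x ∈ Metric.ball 0 ρ) :
    ‖ψ x‖ ≤ c * dist x x₀ := by
  by_contra! hlt
  set d := ‖ψ x‖ with hd
  rw [mem_ball_zero_iff] at hxρ
  have hdist : riemannianEDist (𝓡 n) x₀ x < ENNReal.ofReal (d / c) := by
    rw [← IsRiemannianManifold.out (I := 𝓡 n), edist_dist, dist_comm]
    refine (ENNReal.ofReal_lt_ofReal_iff_of_nonneg dist_nonneg).2 ?_
    rwa [lt_div_iff₀ hc, mul_comm]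
  have hd0 : 0 < d := (by positivity : 0 ≤ c * dist x x₀).trans_lt hlt
  obtain ⟨γ, hγ0, hγ1, hγ, hlen, -⟩ :=
    exists_lt_locally_constant_of_riemannianEDist_lt hdist zero_lt_one
  have hsub : Metric.closedBall 0 d ⊆ ψ.target :=
    (Metric.closedBall_subset_ball hxρ).trans hball
  let u : Set M := ψ.symm '' Metric.closedBall 0 d
  -- As a compact image, `u` is closed in all of `M`, so a curve cannot escape through the edge of
  -- the chart domain.
  have hu : IsClosed u :=
    ((isCompact_closedBall _ _).image_of_continuousOn (ψ.continuousOn_symm.mono hsub)).isClosed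
  have humem {z : M} (hz : z ∈ u) : z ∈ ψ.source ∧ ‖ψ z‖ ≤ d := by
    obtain ⟨w, hw, rfl⟩ := hz
    refine ⟨ψ.map_target (hsub hw), ?_⟩
    rw [ψ.right_inv (hsub hw)]
    simpa using hw
  have hmemu {z : M} (hz : z ∈ ψ.source) (hz' : ‖ψ z‖ ≤ d) : z ∈ u :=
    ⟨ψ z, by simpa using hz', ψ.left_inv hz⟩
  have hlt {t : ℝ} (ht : t ∈ Icc (0 : ℝ) 1) (hmem : Icc 0 t ⊆ γ ⁻¹' u) : ‖ψ (γ t)‖ < d := by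
    have h1 := h.enorm_sub_le_pathELength hc hD hγ ht.1 fun s hs =>
      ⟨(humem (hmem hs)).1, mem_ball_zero_iff.2 ((humem (hmem hs)).2.trans_lt hxρ)⟩
    rw [hγ0, h.apply_self, sub_zero, ← ofReal_norm] at h1
    have h2 : ENNReal.ofReal c * pathELength (𝓡 n) γ 0 t <
        ENNReal.ofReal c * ENNReal.ofReal (d / c) :=
      (ENNReal.mul_lt_mul_iff_right (by simpa using hc) ENNReal.ofReal_ne_top).2
        ((pathELength_mono le_rfl ht.2).trans_lt hlen)
    rw [← ENNReal.ofReal_mul hc.le, mul_div_cancel₀ _ hc.ne'] at h2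
    exact (ENNReal.ofReal_lt_ofReal_iff hd0).1 (h1.trans_lt h2)
  -- Continuous induction on time: the condition is closed, and the strict bound `hlt` lets it
  -- persist a little longer.
  have hall : Icc 0 1 ⊆ γ ⁻¹' u := by
    refine IsClosed.Icc_subset_of_forall_mem_nhdsGT_of_Icc_subset
      ((hu.preimage hγ.continuous).inter isClosed_Icc) ?_ ?_
    · exact hmemu (hγ0 ▸ h.mem_source) (by simp [hγ0, h.apply_self, hd0.le])
    · rintro t ⟨ht0, ht1⟩ hmem
      have h1 := hlt ⟨ht0, ht1.le⟩ hmem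
      have h2 := (humem (hmem (right_mem_Icc.2 ht0))).1
      have h3 : ψ.source ∩ ψ ⁻¹' Metric.ball 0 d ∈ 𝓝 (γ t) :=
        (ψ.isOpen_inter_preimage Metric.isOpen_ball).mem_nhds ⟨h2, by simpa using h1⟩
      refine mem_nhdsWithin_of_mem_nhds (hγ.continuous.continuousAt ?_)
      exact mem_of_superset h3 fun z hz => hmemu hz.1 (by simpa using (mem_ball_zero_iff.1 hz.2).le)
  have := hlt (right_mem_Icc.2 zero_le_one) hall
  rw [hγ1] at this
  exact lt_irrefl _ this

end IsAlmostIsometricChart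

end ChartDistance

/-! ### Scaling, positivity and finiteness of Euclidean weighted norms -/

section EuclideanWeightedNorm

variable {n : ℕ} {w t s k : ℝ} {f u : EuclideanSpace ℝ (Fin n) → ℝ}

theorem lintegral_comp_smul_of_pos (hs : 0 < s) (F : EuclideanSpace ℝ (Fin n) → ℝ≥0∞) :
    ∫⁻ x, F (s • x) = ENNReal.ofReal (s ^ (-(n : ℝ))) * ∫⁻ x, F x := by
  have h1 : ∫⁻ x, F (s • x) =
      ∫⁻ x, F x ∂((volume : Measure (EuclideanSpace ℝ (Fin n))).map (s • ·)) :=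
    ((Homeomorph.smulOfNeZero s hs.ne').measurableEmbedding.lintegral_map F).symm
  rw [h1, Measure.map_addHaar_smul _ hs.ne', lintegral_smul_measure, finrank_euclideanSpace_fin,
    abs_of_pos (by positivity), Real.rpow_neg hs.le, Real.rpow_natCast, smul_eq_mul]

theorem euclideanWeightedNorm_const_mul (ht : 0 < t) (hk : 0 ≤ k) (hf : ∀ x, 0 ≤ f x) :
    euclideanWeightedNorm n w t (fun x => k * f x) =
      ENNReal.ofReal k * euclideanWeightedNorm n w t f := by
  have h1 (x : EuclideanSpace ℝ (Fin n)) : ENNReal.ofReal (‖x‖ ^ (w * t) * (k * f x) ^ t) =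
      ENNReal.ofReal (k ^ t) * ENNReal.ofReal (‖x‖ ^ (w * t) * f x ^ t) := by
    rw [← ENNReal.ofReal_mul (by positivity), Real.mul_rpow hk (hf x)]
    ring_nf
  rw [euclideanWeightedNorm]
  simp_rw [h1]
  rw [lintegral_const_mul' _ _ ENNReal.ofReal_ne_top, ENNReal.mul_rpow_of_nonneg _ _ (by positivity),
    ENNReal.ofReal_rpow_of_nonneg (by positivity) (by positivity), ← Real.rpow_mul hk,
    mul_one_div_cancel ht.ne', Real.rpow_one, euclideanWeightedNorm]

/-- The weight contributes `s ^ (-w)` and Lebesgue measure `s ^ (-n / t)`. -/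
theorem euclideanWeightedNorm_comp_smul (ht : 0 < t) (hs : 0 < s) :
    euclideanWeightedNorm n w t (fun x => f (s • x)) =
      ENNReal.ofReal (s ^ (-(w + n / t))) * euclideanWeightedNorm n w t f := by
  have h1 (x : EuclideanSpace ℝ (Fin n)) : ENNReal.ofReal (‖x‖ ^ (w * t) * f (s • x) ^ t) =
      ENNReal.ofReal (s ^ (-(w * t))) *
        ENNReal.ofReal (‖s • x‖ ^ (w * t) * f (s • x) ^ t) := by
    rw [← ENNReal.ofReal_mul (by positivity), norm_smul, Real.norm_of_nonneg hs.le,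
      Real.mul_rpow hs.le (norm_nonneg x), ← mul_assoc, ← mul_assoc, ← Real.rpow_add hs]
    simp
  rw [euclideanWeightedNorm]
  simp_rw [h1]
  rw [lintegral_const_mul' _ _ ENNReal.ofReal_ne_top,
    lintegral_comp_smul_of_pos hs fun x => ENNReal.ofReal (‖x‖ ^ (w * t) * f x ^ t), ← mul_assoc,
    ← ENNReal.ofReal_mul (by positivity), ← Real.rpow_add hs,
    ENNReal.mul_rpow_of_nonneg _ _ (by positivity),
    ENNReal.ofReal_rpow_of_nonneg (by positivity) (by positivity), ← Real.rpow_mul hs.le,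
    euclideanWeightedNorm]
  congr 3
  field_simp
  ring

theorem gradient_comp_smul (hu : Differentiable ℝ u) (s : ℝ) (x : EuclideanSpace ℝ (Fin n)) :
    gradient (fun y => u (s • y)) x = s • gradient u (s • x) := by
  have h1 : HasFDerivAt (fun y => u (s • y)) (s • fderiv ℝ u (s • x)) x := by
    have h2 : HasFDerivAt (fun y : EuclideanSpace ℝ (Fin n) => s • y)
        (s • ContinuousLinearMap.id ℝ (EuclideanSpace ℝ (Fin n))) x :=
      (hasFDerivAt_id x).const_smul s
    exact ((hu (s • x)).hasFDerivAt.comp x h2).congr_fderiv (by ext; simp)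
  rw [gradient, h1.fderiv, map_smulₛₗ, gradient]
  simp

theorem euclideanWeightedNorm_ne_zero (hn : 0 < n) (ht : 0 < t) (hu : Continuous u)
    (hu0 : u ≠ 0) : euclideanWeightedNorm n w t (fun x => |u x|) ≠ 0 := by
  have : Nonempty (Fin n) := ⟨⟨0, hn⟩⟩
  intro h
  rw [euclideanWeightedNorm, ENNReal.rpow_eq_zero_iff_of_pos (by positivity),
    lintegral_eq_zero_iff (by fun_prop)] at h
  refine hu0 ((hu.ae_eq_iff_eq (volume : Measure (EuclideanSpace ℝ (Fin n))) continuous_zero).1 ?_)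
  -- The weight may vanish at the origin, which is null because the dimension is positive.
  have h0 : ∀ᵐ x : EuclideanSpace ℝ (Fin n), x ≠ 0 := by
    simp [ae_iff]
  filter_upwards [h, h0] with x hx hx0
  by_contra hux
  have : 0 < ‖x‖ ^ (w * t) * |u x| ^ t :=
    mul_pos (Real.rpow_pos_of_pos (norm_pos_iff.2 hx0) _)
      (Real.rpow_pos_of_pos (abs_pos.2 hux) _)
  simp only [Pi.zero_apply, ENNReal.ofReal_eq_zero] at hx
  linarith

/-- The hypothesis `hw` amounts to `w * t > -n`, the condition for the weight to be integrable at
the origin. -/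
theorem euclideanWeightedNorm_ne_top (hn : 0 < n) (ht : 0 < t) (hw : 0 < 1 / t + w / n)
    (hu : Continuous u) (hcomp : HasCompactSupport u) :
    euclideanWeightedNorm n w t (fun x => |u x|) ≠ ⊤ := by
  obtain ⟨R, hR⟩ := hcomp.isCompact.isBounded.subset_ball 0
  obtain ⟨B, hB⟩ := hu.bounded_above_of_compact_support hcomp
  have hB0 : 0 ≤ B := (norm_nonneg _).trans (hB 0)
  refine ENNReal.rpow_ne_top_of_nonneg (by positivity) ?_
  have hint : IntegrableOn (fun x : EuclideanSpace ℝ (Fin n) => ‖x‖ ^ (w * t) * |u x| ^ t)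
      (Metric.ball 0 R) := by
    refine integrableOn_ball_of_norm_le_rpow (C := B ^ t) (α := -(w * t)) ?_ ?_ ?_ ?_
    · rwa [finrank_euclideanSpace_fin]
    · rw [finrank_euclideanSpace_fin]
      have hn' : (0 : ℝ) < n := by exact_mod_cast hn
      have : 0 < (1 / t + w / n) * (t * n) := by positivity
      have h2 : (1 / t + w / n) * (t * n) = n + w * t := by field_simp
      linarith
    · refine Eventually.of_forall fun x => ?_
      rw [neg_neg, Real.norm_of_nonneg (by positivity), mul_comm]
      gcongr
      exact hB x
    · exact Measurable.aestronglyMeasurable (by fun_prop)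
  refine (hint.integrable_of_forall_notMem_eq_zero fun x hx => ?_).lintegral_lt_top.ne
  have : u x = 0 := image_eq_zero_of_notMem_tsupport fun h => hx (hR h)
  rw [this, abs_zero, Real.zero_rpow ht.ne', mul_zero]

end EuclideanWeightedNorm

/-! ### Weighted norms on `M` and on the model space -/

theorem rpow_le_rpow_abs_mul_rpow {c s t : ℝ} (hc : 1 ≤ c) (hs : 0 ≤ s) (ht : 0 ≤ t)
    (hst : s ≤ c * t) (hts : t ≤ c * s) (κ : ℝ) : s ^ κ ≤ c ^ |κ| * t ^ κ := by
  have hc0 : 0 < c := by linarith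
  rcases hs.eq_or_lt with rfl | hs
  · have : t = 0 := by linarith
    rw [this]
    exact le_mul_of_one_le_left (by positivity) (Real.one_le_rpow hc (abs_nonneg κ))
  have ht' : 0 < t := by
    by_contra! h
    have : t = 0 := by linarith
    rw [this] at hst
    linarith
  -- Weight exponents may have either sign, so one or the other of the two comparisons is used.
  rcases le_total 0 κ with hκ | hκ
  · rw [abs_of_nonneg hκ, ← Real.mul_rpow hc0.le ht]
    exact Real.rpow_le_rpow hs.le hst hκ
  · rw [abs_of_nonpos hκ, Real.rpow_neg hc0.le, ← Real.inv_rpow hc0.le,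
      ← Real.mul_rpow (by positivity) ht]
    exact Real.rpow_le_rpow_of_nonpos (by positivity) ((inv_mul_le_iff₀ hc0).2 hts) hκ

section WeightedNormComparison

variable {n : ℕ} {M : Type*} [MetricSpace M] [ChartedSpace (EuclideanSpace ℝ (Fin n)) M]
  [RiemannianBundle (fun x : M => TangentSpace (𝓡 n) x)] {x₀ : M}
  {ψ : OpenPartialHomeomorph M (EuclideanSpace ℝ (Fin n))} {c ρ : ℝ}

/-- The properties of an almost isometric chart on the ball of radius `ρ`: the derivative, the
volume density and the distance to `x₀` are distorted by a factor at most `c`. -/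
structure IsAlmostIsometricOnBall (x₀ : M)
    (ψ : OpenPartialHomeomorph M (EuclideanSpace ℝ (Fin n))) (c ρ : ℝ) : Prop where
  ball_subset : Metric.ball 0 ρ ⊆ ψ.target
  norm_chartDeriv_le : ∀ x ∈ ψ.source, ψ x ∈ Metric.ball 0 ρ → ∀ v : TangentSpace (𝓡 n) x,
    ‖chartDeriv ψ x v‖ ≤ c * ‖v‖
  le_chartDensity : ∀ x ∈ ψ.source, ψ x ∈ Metric.ball 0 ρ → c⁻¹ ≤ chartDensity ψ x
  chartDensity_le : ∀ x ∈ ψ.source, ψ x ∈ Metric.ball 0 ρ → chartDensity ψ x ≤ c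
  dist_le : ∀ x ∈ ψ.source, ψ x ∈ Metric.ball 0 ρ → dist x x₀ ≤ c * ‖ψ x‖
  norm_le : ∀ x ∈ ψ.source, ψ x ∈ Metric.ball 0 ρ → ‖ψ x‖ ≤ c * dist x x₀

theorem IsAlmostIsometricChart.exists_isAlmostIsometricOnBall [IsManifold (𝓡 n) 1 M]
    [IsRiemannianManifold (𝓡 n) M] (h : IsAlmostIsometricChart x₀ ψ) (hc : 1 < c) :
    ∃ ρ > 0, IsAlmostIsometricOnBall x₀ ψ c ρ := by
  obtain ⟨ρ, hρ, hball, hρ'⟩ := h.exists_ball hc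
  have hc0 : 0 < c := by linarith
  exact ⟨ρ, hρ, hball, fun x hx hxρ v => ((hρ' x hx hxρ).1 v).1, fun x hx hxρ => (hρ' x hx hxρ).2.1,
    fun x hx hxρ => (hρ' x hx hxρ).2.2,
    fun x hx hxρ => h.dist_le hc0 hball (fun x hx hxρ v => ((hρ' x hx hxρ).1 v).2) hx hxρ,
    fun x _ hxρ => h.norm_le_dist hc0 hball (fun x hx hxρ v => ((hρ' x hx hxρ).1 v).1) hxρ⟩

variable [MeasurableSpace M] [BorelSpace M] [IsManifold (𝓡 n) 1 M]

theorem IsAlmostIsometricChart.map_riemannianVolume_apply (h : IsAlmostIsometricChart x₀ ψ)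
    (hball : Metric.ball 0 ρ ⊆ ψ.target) {S : Set (EuclideanSpace ℝ (Fin n))}
    (hS : MeasurableSet S) :
    ((riemannianVolume n).restrict (ψ.source ∩ ψ ⁻¹' Metric.ball 0 ρ)).map ψ S =
      ∫⁻ y in S ∩ Metric.ball 0 ρ, ENNReal.ofReal (chartDensity ψ (ψ.symm y)) := by
  have hV : MeasurableSet (ψ.source ∩ ψ ⁻¹' Metric.ball 0 ρ) :=
    (ψ.isOpen_inter_preimage Metric.isOpen_ball).measurableSet
  have hA : MeasurableSet (ψ.source ∩ ψ ⁻¹' (S ∩ Metric.ball 0 ρ)) :=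
    measurableSet_target_inter_preimage_symm ψ.symm (hS.inter measurableSet_ball)
  rw [Measure.map_apply_of_aemeasurable
    ((ψ.continuousOn.mono inter_subset_left).aemeasurable hV) hS, Measure.restrict_apply' hV]
  have h1 : ψ ⁻¹' S ∩ (ψ.source ∩ ψ ⁻¹' Metric.ball 0 ρ) =
      ψ.source ∩ ψ ⁻¹' (S ∩ Metric.ball 0 ρ) := by
    ext x
    simp only [mem_inter_iff, mem_preimage]
    tauto
  rw [h1, riemannianVolume_apply h.mdifferentiable (c := x₀) hA inter_subset_left
    (h.source_eq ▸ inter_subset_left), chartMeasure_apply _ hA]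
  congr 2
  ext y
  constructor
  · rintro ⟨hy, -, hy'⟩
    rwa [mem_preimage, ψ.right_inv hy] at hy'
  · intro hy
    have hyt := hball hy.2
    refine ⟨hyt, ψ.map_target hyt, ?_⟩
    rwa [mem_preimage, ψ.right_inv hyt]

theorem IsAlmostIsometricOnBall.map_riemannianVolume_le (h : IsAlmostIsometricChart x₀ ψ)
    (hb : IsAlmostIsometricOnBall x₀ ψ c ρ) :
    ((riemannianVolume n).restrict (ψ.source ∩ ψ ⁻¹' Metric.ball 0 ρ)).map ψ ≤
      ENNReal.ofReal c • volume.restrict (Metric.ball 0 ρ) := by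
  refine Measure.le_iff.2 fun S hS => ?_
  rw [h.map_riemannianVolume_apply hb.ball_subset hS, Measure.smul_apply,
    Measure.restrict_apply hS, smul_eq_mul, ← setLIntegral_const]
  refine setLIntegral_mono' (hS.inter measurableSet_ball) fun y hy => ?_
  have hyt := hb.ball_subset hy.2
  exact ENNReal.ofReal_le_ofReal (hb.chartDensity_le _ (ψ.map_target hyt)
    (by rw [ψ.right_inv hyt]; exact hy.2))

theorem IsAlmostIsometricOnBall.le_map_riemannianVolume (h : IsAlmostIsometricChart x₀ ψ)
    (hb : IsAlmostIsometricOnBall x₀ ψ c ρ) (hc : 0 < c) :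
    volume.restrict (Metric.ball 0 ρ) ≤ ENNReal.ofReal c •
      ((riemannianVolume n).restrict (ψ.source ∩ ψ ⁻¹' Metric.ball 0 ρ)).map ψ := by
  refine Measure.le_iff.2 fun S hS => ?_
  rw [Measure.smul_apply, h.map_riemannianVolume_apply hb.ball_subset hS,
    Measure.restrict_apply hS, smul_eq_mul, ← lintegral_const_mul' _ _ ENNReal.ofReal_ne_top,
    ← setLIntegral_one]
  refine setLIntegral_mono' (hS.inter measurableSet_ball) fun y hy => ?_
  have hyt := hb.ball_subset hy.2
  have := hb.le_chartDensity _ (ψ.map_target hyt) (by rw [ψ.right_inv hyt]; exact hy.2)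
  rw [← ENNReal.ofReal_mul hc.le, ← ENNReal.ofReal_one]
  exact ENNReal.ofReal_le_ofReal ((inv_le_iff_one_le_mul₀' hc).1 this)

variable {w t k : ℝ} {f : EuclideanSpace ℝ (Fin n) → ℝ} {g : M → ℝ}

theorem measurable_weighted (hf : Measurable f) (w t : ℝ) :
    Measurable fun y => ENNReal.ofReal (‖y‖ ^ (w * t) * f y ^ t) := by
  fun_prop

/-- After taking the `t`-th root, the weight costs `c ^ |w|`, the volume `c ^ (1 / t)`, and the
pointwise bound `k`. The factor `k` is there for gradients, which are themselves distorted. -/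
theorem IsAlmostIsometricOnBall.riemannianWeightedNorm_le (h : IsAlmostIsometricChart x₀ ψ)
    (hb : IsAlmostIsometricOnBall x₀ ψ c ρ) (hc : 1 < c) (ht : 0 < t) (hk : 0 ≤ k)
    (hf : Measurable f) (hf0 : ∀ y, 0 ≤ f y) (hg0 : ∀ x, 0 ≤ g x)
    (hgV : ∀ x ∉ ψ.source ∩ ψ ⁻¹' Metric.ball 0 ρ, g x = 0)
    (hgf : ∀ x ∈ ψ.source ∩ ψ ⁻¹' Metric.ball 0 ρ, g x ≤ k * f (ψ x)) :
    riemannianWeightedNorm n x₀ w t g ≤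
      ENNReal.ofReal (k * c ^ (|w| + 1 / t)) * euclideanWeightedNorm n w t f := by
  have hc0 : 0 < c := by linarith
  have hV : MeasurableSet (ψ.source ∩ ψ ⁻¹' Metric.ball 0 ρ) :=
    (ψ.isOpen_inter_preimage Metric.isOpen_ball).measurableSet
  have hint : ∫⁻ x, ENNReal.ofReal (dist x x₀ ^ (w * t) * g x ^ t) ∂(riemannianVolume n) ≤
      ENNReal.ofReal (c ^ (|w| * t) * k ^ t * c) *
        ∫⁻ y, ENNReal.ofReal (‖y‖ ^ (w * t) * f y ^ t) := by
    calc _ = ∫⁻ x in ψ.source ∩ ψ ⁻¹' Metric.ball 0 ρ,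
          ENNReal.ofReal (dist x x₀ ^ (w * t) * g x ^ t) ∂(riemannianVolume n) := by
          refine (setLIntegral_eq_of_support_subset fun z hz => ?_).symm
          by_contra hzV
          exact hz (by simp [hgV z hzV, Real.zero_rpow ht.ne'])
      _ ≤ ∫⁻ x in ψ.source ∩ ψ ⁻¹' Metric.ball 0 ρ, ENNReal.ofReal (c ^ (|w| * t) * k ^ t) *
          ENNReal.ofReal (‖ψ x‖ ^ (w * t) * f (ψ x) ^ t) ∂(riemannianVolume n) := by
          refine setLIntegral_mono' hV fun x hx => ?_
          rw [← ENNReal.ofReal_mul (by positivity)]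
          refine ENNReal.ofReal_le_ofReal ?_
          have h1 := rpow_le_rpow_abs_mul_rpow hc.le dist_nonneg (norm_nonneg _)
            (hb.dist_le x hx.1 hx.2) (hb.norm_le x hx.1 hx.2) (w * t)
          rw [abs_mul, abs_of_pos ht] at h1
          have h2 : g x ^ t ≤ k ^ t * f (ψ x) ^ t := by
            rw [← Real.mul_rpow hk (hf0 _)]
            exact Real.rpow_le_rpow (hg0 x) (hgf x hx) ht.le
          calc _ ≤ (c ^ (|w| * t) * ‖ψ x‖ ^ (w * t)) * (k ^ t * f (ψ x) ^ t) :=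
                mul_le_mul h1 h2 (Real.rpow_nonneg (hg0 x) _) (by positivity)
            _ = _ := by ring
      _ = ENNReal.ofReal (c ^ (|w| * t) * k ^ t) *
          ∫⁻ y, ENNReal.ofReal (‖y‖ ^ (w * t) * f y ^ t) ∂(((riemannianVolume n).restrict
            (ψ.source ∩ ψ ⁻¹' Metric.ball 0 ρ)).map ψ) := by
          rw [lintegral_const_mul' _ _ ENNReal.ofReal_ne_top,
            lintegral_map' (measurable_weighted hf w t).aemeasurable
            ((ψ.continuousOn.mono inter_subset_left).aemeasurable hV)]
      _ ≤ ENNReal.ofReal (c ^ (|w| * t) * k ^ t) * (ENNReal.ofReal c *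
          ∫⁻ y, ENNReal.ofReal (‖y‖ ^ (w * t) * f y ^ t)) := by
          gcongr
          refine (lintegral_mono' (hb.map_riemannianVolume_le h) le_rfl).trans ?_
          rw [lintegral_smul_measure, smul_eq_mul]
          gcongr
          exact Measure.restrict_le_self
      _ = _ := by rw [← mul_assoc, ← ENNReal.ofReal_mul (by positivity)]
  rw [riemannianWeightedNorm, euclideanWeightedNorm]
  refine (ENNReal.rpow_le_rpow hint (by positivity)).trans_eq ?_
  rw [ENNReal.mul_rpow_of_nonneg _ _ (by positivity),
    ENNReal.ofReal_rpow_of_nonneg (by positivity) (by positivity),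
    Real.mul_rpow (by positivity) (by positivity), Real.mul_rpow (by positivity) (by positivity),
    ← Real.rpow_mul hc0.le, ← Real.rpow_mul hk, mul_one_div_cancel ht.ne', Real.rpow_one,
    mul_assoc |w|, mul_one_div_cancel ht.ne', mul_one, Real.rpow_add hc0]
  congr 2
  ring

theorem IsAlmostIsometricOnBall.euclideanWeightedNorm_le (h : IsAlmostIsometricChart x₀ ψ)
    (hb : IsAlmostIsometricOnBall x₀ ψ c ρ) (hc : 1 < c) (ht : 0 < t)
    (hf : Measurable f) (hf0 : ∀ y, 0 ≤ f y) (hfρ : ∀ y ∉ Metric.ball 0 ρ, f y = 0)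
    (hfg : ∀ x ∈ ψ.source ∩ ψ ⁻¹' Metric.ball 0 ρ, f (ψ x) ≤ g x) :
    euclideanWeightedNorm n w t f ≤
      ENNReal.ofReal (c ^ (|w| + 1 / t)) * riemannianWeightedNorm n x₀ w t g := by
  have hc0 : 0 < c := by linarith
  have hV : MeasurableSet (ψ.source ∩ ψ ⁻¹' Metric.ball 0 ρ) :=
    (ψ.isOpen_inter_preimage Metric.isOpen_ball).measurableSet
  have hint : ∫⁻ y, ENNReal.ofReal (‖y‖ ^ (w * t) * f y ^ t) ≤
      ENNReal.ofReal (c * c ^ (|w| * t)) *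
        ∫⁻ x, ENNReal.ofReal (dist x x₀ ^ (w * t) * g x ^ t) ∂(riemannianVolume n) := by
    calc _ = ∫⁻ y in Metric.ball 0 ρ, ENNReal.ofReal (‖y‖ ^ (w * t) * f y ^ t) := by
          refine (setLIntegral_eq_of_support_subset fun z hz => ?_).symm
          by_contra hzV
          exact hz (by simp [hfρ z hzV, Real.zero_rpow ht.ne'])
      _ ≤ ENNReal.ofReal c * ∫⁻ y, ENNReal.ofReal (‖y‖ ^ (w * t) * f y ^ t)
          ∂(((riemannianVolume n).restrict (ψ.source ∩ ψ ⁻¹' Metric.ball 0 ρ)).map ψ) := by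
          refine (lintegral_mono' (hb.le_map_riemannianVolume h hc0) le_rfl).trans_eq ?_
          rw [lintegral_smul_measure, smul_eq_mul]
      _ = ENNReal.ofReal c * ∫⁻ x in ψ.source ∩ ψ ⁻¹' Metric.ball 0 ρ,
          ENNReal.ofReal (‖ψ x‖ ^ (w * t) * f (ψ x) ^ t) ∂(riemannianVolume n) := by
          rw [lintegral_map' (measurable_weighted hf w t).aemeasurable
            ((ψ.continuousOn.mono inter_subset_left).aemeasurable hV)]
      _ ≤ ENNReal.ofReal c * ∫⁻ x in ψ.source ∩ ψ ⁻¹' Metric.ball 0 ρ,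
          ENNReal.ofReal (c ^ (|w| * t)) *
            ENNReal.ofReal (dist x x₀ ^ (w * t) * g x ^ t) ∂(riemannianVolume n) := by
          gcongr ENNReal.ofReal c * ?_
          refine setLIntegral_mono' hV fun x hx => ?_
          rw [← ENNReal.ofReal_mul (by positivity)]
          refine ENNReal.ofReal_le_ofReal ?_
          have h1 := rpow_le_rpow_abs_mul_rpow hc.le (norm_nonneg _) dist_nonneg
            (hb.norm_le x hx.1 hx.2) (hb.dist_le x hx.1 hx.2) (w * t)
          rw [abs_mul, abs_of_pos ht] at h1
          rw [← mul_assoc]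
          exact mul_le_mul h1 (Real.rpow_le_rpow (hf0 _) (hfg x hx) ht.le)
            (Real.rpow_nonneg (hf0 _) _) (by positivity)
      _ ≤ _ := by
          rw [lintegral_const_mul' _ _ ENNReal.ofReal_ne_top, ← mul_assoc,
            ← ENNReal.ofReal_mul hc0.le]
          gcongr
          exact Measure.restrict_le_self
  rw [riemannianWeightedNorm, euclideanWeightedNorm]
  refine (ENNReal.rpow_le_rpow hint (by positivity)).trans_eq ?_
  rw [ENNReal.mul_rpow_of_nonneg _ _ (by positivity),
    ENNReal.ofReal_rpow_of_nonneg (by positivity) (by positivity),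
    Real.mul_rpow (by positivity) (by positivity),
    ← Real.rpow_mul hc0.le, mul_assoc |w|, mul_one_div_cancel ht.ne', mul_one,
    ← Real.rpow_add hc0, add_comm (1 / t)]

end WeightedNormComparison

/-! ### Pulling test functions back to `M` -/

section ChartPullback

variable {X Y : Type*} [TopologicalSpace X] [TopologicalSpace Y] {ψ : OpenPartialHomeomorph X Y}
  {u : Y → ℝ}

/-- The function `u ∘ ψ`, extended by zero outside of the domain of the chart `ψ`. -/
noncomputable def chartPullback (ψ : OpenPartialHomeomorph X Y) (u : Y → ℝ) : X → ℝ :=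
  ψ.source.indicator fun x => u (ψ x)

theorem chartPullback_of_mem {x : X} (hx : x ∈ ψ.source) : chartPullback ψ u x = u (ψ x) :=
  indicator_of_mem hx _

theorem chartPullback_of_notMem {B : Set Y} (hsupp : tsupport u ⊆ B) {x : X}
    (hx : x ∉ ψ.source ∩ ψ ⁻¹' B) : chartPullback ψ u x = 0 := by
  by_cases h : x ∈ ψ.source
  · rw [chartPullback_of_mem h]
    exact image_eq_zero_of_notMem_tsupport fun h' => hx ⟨h, hsupp h'⟩
  · exact indicator_of_notMem h _

theorem chartPullback_of_notMem_image {x : X} (hx : x ∉ ψ.symm '' tsupport u) :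
    chartPullback ψ u x = 0 := by
  by_cases h : x ∈ ψ.source
  · rw [chartPullback_of_mem h]
    exact image_eq_zero_of_notMem_tsupport fun h' => hx ⟨ψ x, h', ψ.left_inv h⟩
  · exact indicator_of_notMem h _

theorem isCompact_image_tsupport (hcomp : HasCompactSupport u) (hsupp : tsupport u ⊆ ψ.target) :
    IsCompact (ψ.symm '' tsupport u) :=
  hcomp.isCompact.image_of_continuousOn (ψ.continuousOn_symm.mono hsupp)

theorem hasCompactSupport_chartPullback [T2Space X] (hcomp : HasCompactSupport u)
    (hsupp : tsupport u ⊆ ψ.target) : HasCompactSupport (chartPullback ψ u) :=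
  .intro (isCompact_image_tsupport hcomp hsupp) fun _ hx => chartPullback_of_notMem_image hx

theorem chartPullback_eventuallyEq {x : X} (hx : x ∈ ψ.source) :
    chartPullback ψ u =ᶠ[𝓝 x] u ∘ ψ := by
  filter_upwards [ψ.open_source.mem_nhds hx] with z hz using chartPullback_of_mem hz

theorem chartPullback_eventuallyEq_zero [T2Space X] (hcomp : HasCompactSupport u)
    (hsupp : tsupport u ⊆ ψ.target) {x : X} (hx : x ∉ ψ.symm '' tsupport u) :
    chartPullback ψ u =ᶠ[𝓝 x] fun _ => 0 := by
  filter_upwards [(isCompact_image_tsupport hcomp hsupp).isClosed.isOpen_compl.mem_nhds hx]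
    with z hz using chartPullback_of_notMem_image hz

end ChartPullback

section ChartPullbackGradient

variable {n : ℕ} {M : Type*} [MetricSpace M] [ChartedSpace (EuclideanSpace ℝ (Fin n)) M]
  [RiemannianBundle (fun x : M => TangentSpace (𝓡 n) x)]
  {x₀ : M} {ψ : OpenPartialHomeomorph M (EuclideanSpace ℝ (Fin n))}
  {u : EuclideanSpace ℝ (Fin n) → ℝ} {c ρ : ℝ}

/-- The chart domain and the complement of the compact image of the support form an open cover of
`M`; the function is `u ∘ ψ` on the first and zero on the second. -/
theorem contMDiff_chartPullback (h : IsAlmostIsometricChart x₀ ψ) (hu : ContDiff ℝ ∞ u)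
    (hcomp : HasCompactSupport u) (hsupp : tsupport u ⊆ ψ.target) :
    ContMDiff (𝓡 n) 𝓘(ℝ, ℝ) ∞ (chartPullback ψ u) := by
  intro x
  by_cases hx : x ∈ ψ.symm '' tsupport u
  · have hx' : x ∈ ψ.source := by
      obtain ⟨y, hy, rfl⟩ := hx
      exact ψ.map_target (hsupp hy)
    have h1 : ContMDiffAt (𝓡 n) (𝓡 n) ∞ ψ x :=
      (h.contMDiffOn x hx').contMDiffAt (ψ.open_source.mem_nhds hx')
    exact (hu.contMDiff.contMDiffAt.comp x h1).congr_of_eventuallyEq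
      (chartPullback_eventuallyEq hx')
  · exact contMDiffAt_const.congr_of_eventuallyEq (chartPullback_eventuallyEq_zero hcomp hsupp hx)

theorem norm_gradient_eq (u : EuclideanSpace ℝ (Fin n) → ℝ) (y : EuclideanSpace ℝ (Fin n)) :
    ‖gradient u y‖ = ‖fderiv ℝ u y‖ :=
  LinearIsometryEquiv.norm_map _ _

theorem norm_riemannianGradient_eq {g : M → ℝ} {x : M} {L : TangentSpace (𝓡 n) x →L[ℝ] ℝ}
    (hL : HasMFDerivAt (𝓡 n) 𝓘(ℝ, ℝ) g x L) : ‖riemannianGradient n g x‖ = ‖L‖ := by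
  have : FiniteDimensional ℝ (TangentSpace (𝓡 n) x) :=
    inferInstanceAs (FiniteDimensional ℝ (EuclideanSpace ℝ (Fin n)))
  have : CompleteSpace (TangentSpace (𝓡 n) x) := FiniteDimensional.complete ℝ _
  have h : (mfderiv (𝓡 n) 𝓘(ℝ, ℝ) g x : TangentSpace (𝓡 n) x →L[ℝ] ℝ) = L := hL.mfderiv
  subst h
  exact (InnerProductSpace.toDual ℝ (TangentSpace (𝓡 n) x)).symm.norm_map _

/-- By Riesz, gradient norms are dual norms of differentials, and the chain rule composes the
differential of `u` with that of `ψ`, of norm at most `c`. -/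
theorem norm_riemannianGradient_chartPullback_le (h : IsAlmostIsometricChart x₀ ψ)
    (hb : IsAlmostIsometricOnBall x₀ ψ c ρ) (hc : 0 < c) (hu : Differentiable ℝ u) {x : M}
    (hx : x ∈ ψ.source ∩ ψ ⁻¹' Metric.ball 0 ρ) :
    ‖riemannianGradient n (chartPullback ψ u) x‖ ≤ c * ‖gradient u (ψ x)‖ := by
  have h1 : HasMFDerivAt (𝓡 n) 𝓘(ℝ, ℝ) (chartPullback ψ u) x
      ((fderiv ℝ u (ψ x)).comp (chartDeriv ψ x)) :=
    ((hu (ψ x)).hasFDerivAt.hasMFDerivAt.comp x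
      (h.mdifferentiable.mdifferentiableAt hx.1).hasMFDerivAt).congr_of_eventuallyEq
      (chartPullback_eventuallyEq hx.1)
  rw [norm_riemannianGradient_eq h1, norm_gradient_eq]
  refine ContinuousLinearMap.opNorm_le_bound _ (by positivity) fun v => ?_
  calc _ ≤ ‖fderiv ℝ u (ψ x)‖ * ‖chartDeriv ψ x v‖ := ContinuousLinearMap.le_opNorm _ _
    _ ≤ ‖fderiv ℝ u (ψ x)‖ * (c * ‖v‖) := by
        gcongr
        exact hb.norm_chartDeriv_le x hx.1 hx.2 v
    _ = c * ‖fderiv ℝ u (ψ x)‖ * ‖v‖ := by ring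

theorem riemannianGradient_chartPullback_of_notMem (hcomp : HasCompactSupport u)
    (hball : Metric.ball 0 ρ ⊆ ψ.target) (hsupp : tsupport u ⊆ Metric.ball 0 ρ) {x : M}
    (hx : x ∉ ψ.source ∩ ψ ⁻¹' Metric.ball 0 ρ) :
    ‖riemannianGradient n (chartPullback ψ u) x‖ = 0 := by
  have hx' : x ∉ ψ.symm '' tsupport u := by
    rintro ⟨y, hy, rfl⟩
    have hyt := hball (hsupp hy)
    refine hx ⟨ψ.map_target hyt, ?_⟩
    rw [mem_preimage, ψ.right_inv hyt]
    exact hsupp hy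
  have h1 : HasMFDerivAt (𝓡 n) 𝓘(ℝ, ℝ) (chartPullback ψ u) x
      (0 : TangentSpace (𝓡 n) x →L[ℝ] ℝ) :=
    (hasMFDerivAt_const (0 : ℝ) x).congr_of_eventuallyEq
      (chartPullback_eventuallyEq_zero hcomp (hsupp.trans hball) hx')
  exact (norm_riemannianGradient_eq h1).trans
    (norm_zero (E := TangentSpace (𝓡 n) x →L[ℝ] ℝ))

end ChartPullbackGradient

/-! ### Localization and rescaling -/

section Blowup

variable {n : ℕ} {M : Type*} [MetricSpace M] [ChartedSpace (EuclideanSpace ℝ (Fin n)) M]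
  [RiemannianBundle (fun x : M => TangentSpace (𝓡 n) x)] [MeasurableSpace M]
  {x₀ : M} {ψ : OpenPartialHomeomorph M (EuclideanSpace ℝ (Fin n))}
  {u : EuclideanSpace ℝ (Fin n) → ℝ} {c ρ p q r α β γ a C : ℝ}

/-- The distortion exponent of the Caffarelli-Kohn-Nirenberg inequality under an almost isometric
chart. -/
noncomputable def cknDistortionExponent (p q r α β γ a : ℝ) : ℝ :=
  (|γ| + 1 / r) + (1 + (|α| + 1 / p)) * a + (|β| + 1 / q) * (1 - a)

theorem ckn_of_tsupport_subset_ball [BorelSpace M] [IsManifold (𝓡 n) 1 M]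
    (hp : 0 < p) (hq : 0 < q) (hr : 0 < r) (ha₀ : 0 ≤ a) (ha₁ : a ≤ 1)
    (hCKN : ∀ u : M → ℝ, ContMDiff (𝓡 n) 𝓘(ℝ, ℝ) ∞ u → HasCompactSupport u →
      riemannianWeightedNorm n x₀ γ r (fun x => |u x|) ≤
        ENNReal.ofReal C *
          riemannianWeightedNorm n x₀ α p (fun x => ‖riemannianGradient n u x‖) ^ a *
          riemannianWeightedNorm n x₀ β q (fun x => |u x|) ^ (1 - a))
    (h : IsAlmostIsometricChart x₀ ψ) (hb : IsAlmostIsometricOnBall x₀ ψ c ρ) (hc : 1 < c)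
    (hu : ContDiff ℝ ∞ u) (hcomp : HasCompactSupport u) (hsupp : tsupport u ⊆ Metric.ball 0 ρ) :
    euclideanWeightedNorm n γ r (fun x => |u x|) ≤
      ENNReal.ofReal (c ^ cknDistortionExponent p q r α β γ a) * ENNReal.ofReal C *
        euclideanWeightedNorm n α p (fun x => ‖gradient u x‖) ^ a *
        euclideanWeightedNorm n β q (fun x => |u x|) ^ (1 - a) := by
  have hc0 : 0 < c := by linarith
  have ha₁' : 0 ≤ 1 - a := by linarith
  have hgrad : Measurable fun y => ‖gradient u y‖ := by
    simp_rw [norm_gradient_eq]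
    exact (hu.continuous_fderiv (by simp)).norm.measurable
  have habs : Measurable fun y => |u y| := hu.continuous.abs.measurable
  -- The left side is transferred from Euclidean space to `M`, and the two right-hand factors back
  -- from `M`. Every transfer loses a power of `c`; the total is `cknDistortionExponent`.
  have hN := hb.euclideanWeightedNorm_le (w := γ) h hc hr habs (fun _ => abs_nonneg _)
    (fun y hy => by rw [image_eq_zero_of_notMem_tsupport fun h' => hy (hsupp h'), abs_zero])
    (fun x hx => (congrArg abs (chartPullback_of_mem (u := u) hx.1)).ge)
  have hQ := hb.riemannianWeightedNorm_le (w := β) (k := 1) h hc hq zero_le_one habs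
    (fun _ => abs_nonneg _) (g := fun x => |chartPullback ψ u x|) (fun _ => abs_nonneg _)
    (fun x hx => by rw [chartPullback_of_notMem hsupp hx, abs_zero])
    (fun x hx => by rw [one_mul, chartPullback_of_mem hx.1])
  have hP := hb.riemannianWeightedNorm_le (w := α) (k := c) h hc hp hc0.le hgrad
    (fun _ => norm_nonneg _) (g := fun x => ‖riemannianGradient n (chartPullback ψ u) x‖)
    (fun _ => norm_nonneg _)
    (fun x hx => riemannianGradient_chartPullback_of_notMem hcomp hb.ball_subset hsupp hx)
    (fun x hx => norm_riemannianGradient_chartPullback_le h hb hc0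
      (hu.differentiable (by simp)) hx)
  have hM := hCKN (chartPullback ψ u)
    (contMDiff_chartPullback h hu hcomp (hsupp.trans hb.ball_subset))
    (hasCompactSupport_chartPullback hcomp (hsupp.trans hb.ball_subset))
  set P := euclideanWeightedNorm n α p (fun x => ‖gradient u x‖)
  set Q := euclideanWeightedNorm n β q (fun x => |u x|)
  calc _ ≤ _ := hN
    _ ≤ ENNReal.ofReal (c ^ (|γ| + 1 / r)) * (ENNReal.ofReal C *
        (ENNReal.ofReal (c * c ^ (|α| + 1 / p)) * P) ^ a *
        (ENNReal.ofReal (1 * c ^ (|β| + 1 / q)) * Q) ^ (1 - a)) := by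
        gcongr
        refine hM.trans ?_
        gcongr
    _ = _ := by
        have e1 : c * c ^ (|α| + 1 / p) = c ^ (1 + (|α| + 1 / p)) := by
          rw [Real.rpow_add hc0 1, Real.rpow_one]
        have e2 : c ^ cknDistortionExponent p q r α β γ a = c ^ (|γ| + 1 / r) *
            c ^ ((1 + (|α| + 1 / p)) * a) * c ^ ((|β| + 1 / q) * (1 - a)) := by
          rw [← Real.rpow_add hc0, ← Real.rpow_add hc0, cknDistortionExponent]
        rw [one_mul, e1, ENNReal.mul_rpow_of_nonneg _ _ ha₀, ENNReal.mul_rpow_of_nonneg _ _ ha₁',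
          ENNReal.ofReal_rpow_of_pos (by positivity), ENNReal.ofReal_rpow_of_pos (by positivity),
          ← Real.rpow_mul hc0.le, ← Real.rpow_mul hc0.le, e2, ENNReal.ofReal_mul (by positivity),
          ENNReal.ofReal_mul (by positivity)]
        ring

/-- The Caffarelli-Kohn-Nirenberg inequality for a rescaled function implies that for the function
itself. -/
theorem ckn_of_comp_smul (hn : 0 < n) (hp : 0 < p) (hq : 0 < q) (hr : 0 < r) (ha₀ : 0 ≤ a)
    (ha₁ : a ≤ 1)
    (hbal : 1 / r + γ / n = a * (1 / p + (α - 1) / n) + (1 - a) * (1 / q + β / n))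
    (hu : Differentiable ℝ u) {K : ℝ≥0∞} {s : ℝ} (hs : 0 < s)
    (h : euclideanWeightedNorm n γ r (fun x => |u (s • x)|) ≤
      K * euclideanWeightedNorm n α p (fun x => ‖gradient (fun y => u (s • y)) x‖) ^ a *
        euclideanWeightedNorm n β q (fun x => |u (s • x)|) ^ (1 - a)) :
    euclideanWeightedNorm n γ r (fun x => |u x|) ≤
      K * euclideanWeightedNorm n α p (fun x => ‖gradient u x‖) ^ a *
        euclideanWeightedNorm n β q (fun x => |u x|) ^ (1 - a) := by
  have ha₁' : 0 ≤ 1 - a := by linarith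
  simp_rw [gradient_comp_smul hu, norm_smul, Real.norm_of_nonneg hs.le] at h
  rw [euclideanWeightedNorm_comp_smul (f := fun y => |u y|) hr hs,
    euclideanWeightedNorm_comp_smul (f := fun y => |u y|) hq hs,
    euclideanWeightedNorm_const_mul (f := fun y => ‖gradient u (s • y)‖) hp hs.le
      (fun _ => norm_nonneg _),
    euclideanWeightedNorm_comp_smul (f := fun y => ‖gradient u y‖) hp hs,
    ← mul_assoc (ENNReal.ofReal s), ← ENNReal.ofReal_mul hs.le] at h
  set P := euclideanWeightedNorm n α p (fun x => ‖gradient u x‖)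
  set Q := euclideanWeightedNorm n β q (fun x => |u x|)
  set N := euclideanWeightedNorm n γ r (fun x => |u x|)
  have e1 : s * s ^ (-(α + n / p)) = s ^ (1 + -(α + n / p)) := by
    rw [Real.rpow_add hs 1, Real.rpow_one]
  have hn' : (0 : ℝ) < n := by exact_mod_cast hn
  -- The balance condition multiplied by `-n`: both sides of the inequality scale by the same power
  -- of `s`, which then cancels.
  have e2 : -(γ + n / r) = (1 + -(α + n / p)) * a + -(β + n / q) * (1 - a) := by
    have := congrArg (fun z => -((n : ℝ) * z)) hbal
    field_simp at this ⊢
    linarith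
  rw [e1, ENNReal.mul_rpow_of_nonneg _ _ ha₀, ENNReal.mul_rpow_of_nonneg _ _ ha₁',
    ENNReal.ofReal_rpow_of_pos (by positivity), ENNReal.ofReal_rpow_of_pos (by positivity),
    ← Real.rpow_mul hs.le, ← Real.rpow_mul hs.le] at h
  have h2 : ENNReal.ofReal (s ^ (-(γ + n / r))) * N ≤
      ENNReal.ofReal (s ^ (-(γ + n / r))) * (K * P ^ a * Q ^ (1 - a)) := by
    refine h.trans_eq ?_
    rw [e2, Real.rpow_add hs, ENNReal.ofReal_mul (by positivity)]
    ring
  exact (ENNReal.mul_le_mul_iff_right (by simpa using by positivity) ENNReal.ofReal_ne_top).1 h2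

theorem exists_pos_tsupport_comp_smul_subset_ball (hcomp : HasCompactSupport u) (hρ : 0 < ρ) :
    ∃ s : ℝ, 0 < s ∧ HasCompactSupport (fun x => u (s • x)) ∧
      tsupport (fun x => u (s • x)) ⊆ Metric.ball 0 ρ := by
  obtain ⟨R, hR0, hR⟩ := hcomp.isCompact.isBounded.exists_pos_norm_le
  -- The support, of radius at most `R`, shrinks to radius `R * ρ / (R + 1) < ρ`.
  have hs : 0 < (R + 1) / ρ := by positivity
  refine ⟨(R + 1) / ρ, hs, hcomp.comp_homeomorph (Homeomorph.smulOfNeZero _ hs.ne'), ?_⟩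
  intro x hx
  have h1 : ((R + 1) / ρ) • x ∈ tsupport u :=
    tsupport_comp_subset_preimage u (continuous_const_smul ((R + 1) / ρ)) hx
  have h2 := hR _ h1
  rw [norm_smul, Real.norm_of_nonneg hs.le, div_mul_eq_mul_div, div_le_iff₀ hρ] at h2
  rw [mem_ball_zero_iff]
  by_contra! h3
  nlinarith

end Blowup

/-! ### The comparison of constants -/

theorem theorem1p4 (n : ℕ) (hn : 2 ≤ n)
    {M : Type*} [MetricSpace M] [CompleteSpace M] [NoncompactSpace M]
    [ChartedSpace (EuclideanSpace ℝ (Fin n)) M] [IsManifold (𝓡 n) ∞ M]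
    [RiemannianBundle (fun x : M => TangentSpace (𝓡 n) x)]
    [IsContMDiffRiemannianBundle (𝓡 n) ∞ (EuclideanSpace ℝ (Fin n))
      (fun x : M => TangentSpace (𝓡 n) x)]
    [IsRiemannianManifold (𝓡 n) M] [MeasurableSpace M] [BorelSpace M]
    (x₀ : M) (p q r α β γ σ a : ℝ)
    (hp : 1 ≤ p) (hq : 1 ≤ q) (hr : 0 < r) (ha₀ : 0 ≤ a) (ha₁ : a ≤ 1)
    (hpα : 0 < 1 / p + α / n) (hqβ : 0 < 1 / q + β / n) (hrγ : 0 < 1 / r + γ / n)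
    (hγ : γ = a * σ + (1 - a) * β)
    (hbal : 1 / r + γ / n = a * (1 / p + (α - 1) / n) + (1 - a) * (1 / q + β / n))
    (hσ₀ : 0 < a → 0 ≤ α - σ)
    (hσ₁ : 0 < a → 1 / p + (α - 1) / n = 1 / r + γ / n → α - σ ≤ 1)
    (C : ℝ)
    (hCKN : ∀ u : M → ℝ, ContMDiff (𝓡 n) 𝓘(ℝ, ℝ) ∞ u → HasCompactSupport u →
      riemannianWeightedNorm n x₀ γ r (fun x => |u x|) ≤
        ENNReal.ofReal C *
          riemannianWeightedNorm n x₀ α p (fun x => ‖riemannianGradient n u x‖) ^ a *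
          riemannianWeightedNorm n x₀ β q (fun x => |u x|) ^ (1 - a)) :
    (euclideanCKNBestConstant n p q r α β γ a : EReal) ≤ (C : EReal) := by
  have hn0 : 0 < n := by omega
  have hp0 : 0 < p := by linarith
  have hq0 : 0 < q := by linarith
  have : IsContinuousRiemannianBundle (EuclideanSpace ℝ (Fin n))
      (fun x : M => TangentSpace (𝓡 n) x) := by
    obtain ⟨g, hg, hg'⟩ := IsContMDiffRiemannianBundle.exists_contMDiff (IB := 𝓡 n) (n := ∞)
      (F := EuclideanSpace ℝ (Fin n)) (E := fun x : M => TangentSpace (𝓡 n) x)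
    exact ⟨g, hg.continuous, hg'⟩
  obtain ⟨ψ, hψ⟩ := exists_isAlmostIsometricChart (n := n) x₀
  have key (u : EuclideanSpace ℝ (Fin n) → ℝ) (hu : ContDiff ℝ ∞ u) (hcomp : HasCompactSupport u) :
      euclideanWeightedNorm n γ r (fun x => |u x|) ≤
        ENNReal.ofReal C * (euclideanWeightedNorm n α p (fun x => ‖gradient u x‖) ^ a *
          euclideanWeightedNorm n β q (fun x => |u x|) ^ (1 - a)) := by
    have h1 (c : ℝ) (hc : 1 < c) :
        euclideanWeightedNorm n γ r (fun x => |u x|) ≤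
          ENNReal.ofReal (c ^ cknDistortionExponent p q r α β γ a) * ENNReal.ofReal C *
            euclideanWeightedNorm n α p (fun x => ‖gradient u x‖) ^ a *
            euclideanWeightedNorm n β q (fun x => |u x|) ^ (1 - a) := by
      obtain ⟨ρ, hρ, hb⟩ := hψ.exists_isAlmostIsometricOnBall hc
      obtain ⟨s, hs, hcomp', hsupp⟩ := exists_pos_tsupport_comp_smul_subset_ball hcomp hρ
      exact ckn_of_comp_smul hn0 hp0 hq0 hr ha₀ ha₁ hbal (hu.differentiable (by simp)) hs
        (ckn_of_tsupport_subset_ball hp0 hq0 hr ha₀ ha₁ hCKN hψ hb hc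
          (hu.comp (contDiff_const_smul s)) hcomp' hsupp)
    have h2 : Tendsto (fun c : ℝ => ENNReal.ofReal (c ^ cknDistortionExponent p q r α β γ a))
        (𝓝[>] 1) (𝓝 1) := by
      have h3 := (Real.continuousAt_rpow_const 1 (cknDistortionExponent p q r α β γ a)
        (Or.inl one_ne_zero)).tendsto
      have h4 := ((ENNReal.continuous_ofReal.tendsto _).comp h3).mono_left
        (nhdsWithin_le_nhds (s := Ioi 1))
      simpa [Function.comp_def] using h4
    -- The fixed factor may be infinite; multiplication is still continuous here because the limit
    -- `1` is nonzero.
    have h3 := ENNReal.Tendsto.mul_const (b := ENNReal.ofReal C *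
      (euclideanWeightedNorm n α p (fun x => ‖gradient u x‖) ^ a *
        euclideanWeightedNorm n β q (fun x => |u x|) ^ (1 - a))) h2 (Or.inl one_ne_zero)
    rw [one_mul] at h3
    refine ge_of_tendsto h3 ?_
    filter_upwards [self_mem_nhdsWithin] with c hc
    refine (h1 c hc).trans_eq ?_
    ring
  -- `ENNReal.ofReal` truncates negative `C` to `0`, while the conclusion compares with `C` itself.
  -- For `C ≤ 0` the inequality would force the norm of a bump function to vanish.
  have hC : 0 < C := by
    by_contra! hC
    let b : ContDiffBump (0 : EuclideanSpace ℝ (Fin n)) := ⟨1, 2, one_pos, one_lt_two⟩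
    have h1 := key b b.contDiff b.hasCompactSupport
    rw [ENNReal.ofReal_eq_zero.2 hC, zero_mul, nonpos_iff_eq_zero] at h1
    refine euclideanWeightedNorm_ne_zero hn0 hr b.continuous (fun h => ?_) h1
    have h2 := b.one_of_mem_closedBall (Metric.mem_closedBall_self zero_le_one)
    rw [h] at h2
    exact zero_ne_one h2
  have hle : euclideanCKNBestConstant n p q r α β γ a ≤ ENNReal.ofReal C := by
    rw [euclideanCKNBestConstant, ENNReal.inv_le_iff_inv_le]
    refine le_iInf₂ fun u hu => ?_
    obtain ⟨hu, hcomp, hu0⟩ := hu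
    -- Clearing the denominator requires it to be neither `0` nor `⊤`; finiteness is where `hrγ`
    -- enters.
    rw [euclideanCKNQuotient, ENNReal.le_div_iff_mul_le
      (Or.inl (euclideanWeightedNorm_ne_zero hn0 hr hu.continuous hu0))
      (Or.inl (euclideanWeightedNorm_ne_top hn0 hr hrγ hu.continuous hcomp)),
      ENNReal.inv_mul_le_iff (by simpa using hC) ENNReal.ofReal_ne_top]
    exact key u hu hcomp
  refine (EReal.coe_ennreal_le_coe_ennreal_iff.2 hle).trans_eq ?_
  rw [EReal.coe_ennreal_ofReal, max_eq_left hC.le]
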